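/- **Conventions.** A ribbon graph is a finite connected graph, all of whose vertices have valency at least $3$, with a cyclic (counterclockwise) order of the half-edges at each vertex. An orientation is given by an ordering of the vertices and a direction of every edge, up to an even number of vertex swaps and edge reversals. Let $r\mathcal G[n]$ be the rational vector space spanned by the isomorphism classes of oriented ribbon graphs with $n$ vertices, modulo $(X,-or)=-(X,or)$. The boundary $d\colon r\mathcal G[n]\to r\mathcal G[n-1]$ sends $X$ to the sum of the contractions of its non-loop edges; the vertices are first reordered so that the contracted edge goes from vertex $1$ to vertex $2$, and after the contraction the new vertex comes first and the others are shifted down by one. A graph has a cut vertex if a properly embedded arc in its thickening that meets the graph only in that vertex disconnects the thickened surface into two pieces, both of which contain edges. The graphs with cut vertices span a subcomplex $\mathcal C$, and $\overline{r\mathcal G}=r\mathcal G/\mathcal C$ is the reduced ribbon graph complex. For a sequence $t_1,\dots,t_n$ ($n\ge1$) of planar binary rooted trees let $G(t_1,\dots,t_n)$ be the following oriented ribbon graph. It has a large loop of $n$ directed edges through the roots $r_1,\dots,r_n$ of the trees, the $j$-th one running from $r_j$ to $r_{j+1}$ (indices mod $n$). The counterclockwise cyclic order at $r_j$ is: the loop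 edge out of $r_j$, the lowest edge (root edge) of $t_j$, the loop edge into $r_j$, and then, from left to right, the ends of the edges which emanate from the tops of $t_j$ (one for each leaf); these edges run back to $r_j$ as parallel strands, so there are no vertices at the leaves. At an internal vertex of $t_j$ the counterclockwise order is: edge from below, edge to the right child, edge to the left child. Tree edges are directed away from the root. The vertices are ordered tree by tree; within $t_j$ the root $r_j$ comes first, followed by the internal vertices from left to right (the $p$-th one lies between the $p$-th and the $(p+1)$-st leaf). Thus the number of vertices of $G(t_1,\dots,t_n)$ is the total number of leaves of the trees. The *ornate necklace* $[i_1,\dots,i_n]$ is the sum of $G(t_1,\dots,t_n)$ over all $t_1,\dots,t_n$ such that $t_j$ has $i_j\geq 1$ leaves. Let $|i_1,\dots,i_n|$ be the number of cyclic permutations which fix the sequence $(i_1,\dots,i_n)$. **Statement.** 1. For all $k\ge 1$ and all positive integers $i_1,\dots,i_n$ with $i_1+\dots+i_n=k$: (a) the contractions of the interior tree edges (those joining two internal vertices of a tree) in the summands of $[i_1,\dots,i_n]$ cancel in pairs: there is a fixed-point-free involution on the set of pairs (summand, interior edge) such that the contractions for corresponding pairs are negatives of each other in $r\mathcal G$;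 (b) contracting any non-loop edge which emanates from the top of a tree gives a graph with a cut vertex; (c) consequently, in $\overline{r\mathcal G}$ the boundary $d[i_1,\dots,i_n]$ is the sum of the contractions of the (non-loop) root edges of the trees and of the (non-loop) edges of the large loop in the summands of $[i_1,\dots,i_n]$. 2. For all trees $t_1,t_2,\dots,t_n$ ($n\ge2$) the contraction of the edge of the large loop from $r_1$ to $r_2$ in $G(t_1,t_2,t_3,\dots,t_n)$ and the contraction of the root edge of $t_1\vee t_2$ in $G(t_1\vee t_2,t_3,\dots,t_n)$ are the same element of $r\mathcal G$, with the same sign; here $t_1\vee t_2$ is the binary tree with left branch $t_1$ and right branch $t_2$. (The two necklaces have numbers of entries $n$ and $n-1$, so these terms cancel in the sum below.) 3. Let $k\ge1$ be odd. Then $[i_1,\dots,i_n]\in r\mathcal G[k]$ is invariant under cyclic permutations of $(i_1,\dots,i_n)$ whenever $i_1+\dots+i_n=k$, so that $$Z_k=\sum (-1)^n\,\frac{[i_1,\dots,i_n]}{|i_1,\dots,i_n|}\in r\mathcal G[k]$$ is well defined, where the sum is over the sequences of positive integers with $i_1+\dots+i_n=k$ up to cyclic permutation. It is a cycle in the reduced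 ribbon graph complex: $$d(Z_k)=0\quad\text{in }\overline{r\mathcal G}.$$ -/

import Mathlib

open scoped List

/-! ### Cyclic sequences -/

section CyclicSequences

variable {α : Type*} [DecidableEq α]

/-- The elements of the cyclic sequence `l` other than `h`, read off starting just after `h`. -/
def after (h : α) (l : List α) : List α :=
  l.drop (l.idxOf h + 1) ++ l.take (l.idxOf h)

theorem isRotated_cons_after {h : α} {l : List α} (hl : h ∈ l) : l ~r h :: after h l := by
  refine ⟨l.idxOf h, ?_⟩
  have hlt : l.idxOf h < l.length := List.idxOf_lt_length_iff.2 hl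
  rw [List.rotate_eq_drop_append_take hlt.le, List.drop_eq_getElem_cons hlt]
  simp [after]

theorem perm_cons_after {h : α} {l : List α} (hl : h ∈ l) : l ~ h :: after h l :=
  (isRotated_cons_after hl).perm

theorem eq_of_cons_isRotated_cons {α : Type*} {h : α} {x y : List α} (hn : (h :: x).Nodup)
    (hr : h :: x ~r h :: y) : x = y := by
  obtain ⟨m, hm⟩ := hr
  have h1 : m % (h :: x).length = 0 := by
    by_contra hne
    have hlt : m % (h :: x).length < (h :: x).length := Nat.mod_lt _ (by simp)
    rw [← List.rotate_mod, List.rotate_eq_drop_append_take hlt.le,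
      List.drop_eq_getElem_cons hlt] at hm
    have h2 : (h :: x)[m % (h :: x).length] = h := by
      have := congrArg List.head? hm
      simpa using this
    have h3 : (h :: x)[m % (h :: x).length] = (h :: x)[0] := by simpa using h2
    exact hne ((List.Nodup.getElem_inj_iff hn).1 h3)
  rw [← List.rotate_mod, h1, List.rotate_zero] at hm
  exact (List.cons.inj hm).2

theorem after_eq {h : α} {l x : List α} (hn : l.Nodup) (hl : h ∈ l) (hr : l ~r h :: x) :
    after h l = x := by
  have h1 := isRotated_cons_after hl
  have h2 : h :: after h l ~r h :: x := h1.symm.trans hr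
  exact eq_of_cons_isRotated_cons ((h1.nodup_iff).1 hn) h2

end CyclicSequences

/-! ### Ribbon graphs -/

/-- Edges are labelled by natural numbers and directed: `(e, false)` is the half-edge at the
start of the edge `e`, and `(e, true)` is the half-edge at its end. -/
abbrev HalfEdge : Type := ℕ × Bool

section CountLemmas

variable {n : ℕ} {cyc : Fin n → List HalfEdge} {edges : Finset ℕ}

theorem vertex_unique_of_count
    (hc : ∀ h : HalfEdge, ∑ i, (cyc i).count h = if h.1 ∈ edges then 1 else 0)
    {h : HalfEdge} {i j : Fin n} (hi : h ∈ cyc i) (hj : h ∈ cyc j) : i = j := by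
  by_contra hne
  have h1 := hc h
  have h2 : ∑ m ∈ {i, j}, (cyc m).count h ≤ ∑ m, (cyc m).count h :=
    Finset.sum_le_sum_of_subset (Finset.subset_univ _)
  rw [Finset.sum_pair hne] at h2
  have h3 := List.count_pos_iff.2 hi
  have h4 := List.count_pos_iff.2 hj
  split_ifs at h1 <;> omega

theorem mem_edges_of_count
    (hc : ∀ h : HalfEdge, ∑ i, (cyc i).count h = if h.1 ∈ edges then 1 else 0)
    {h : HalfEdge} {i : Fin n} (hi : h ∈ cyc i) : h.1 ∈ edges := by
  by_contra hne
  have := hc h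
  rw [if_neg hne, Finset.sum_eq_zero_iff] at this
  exact (List.count_eq_zero.1 (this i (Finset.mem_univ i))) hi

theorem exists_vertex_of_count
    (hc : ∀ h : HalfEdge, ∑ i, (cyc i).count h = if h.1 ∈ edges then 1 else 0)
    {h : HalfEdge} (hh : h.1 ∈ edges) : ∃ i, h ∈ cyc i := by
  by_contra! hne
  have h1 := hc h
  rw [if_pos hh, Finset.sum_eq_zero fun i _ => List.count_eq_zero.2 (hne i)] at h1
  omega

end CountLemmas

/-- A ribbon graph with `n` vertices, numbered by `Fin n`, and directed edges; the vertex order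
and the edge directions represent an orientation.  `cyc i` lists the half-edges at the vertex
`i` in their (counterclockwise) cyclic order. -/
structure RibbonGraph (n : ℕ) where
  edges : Finset ℕ
  cyc : Fin n → List HalfEdge
  /-- Each half-edge of an edge of the graph occurs exactly once, and nothing else occurs. -/
  count_eq : ∀ h : HalfEdge, ∑ i, (cyc i).count h = if h.1 ∈ edges then 1 else 0
  valence : ∀ i, 3 ≤ (cyc i).length
  pos : 0 < n
  connected : ∀ T : Set (Fin n), T.Nonempty →
    (∀ i j e b, (e, b) ∈ cyc i → (e, !b) ∈ cyc j → i ∈ T → j ∈ T) → T = Set.univ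

namespace RibbonGraph

variable {n : ℕ}

theorem mem_edges (X : RibbonGraph n) {h : HalfEdge} {i : Fin n} (hi : h ∈ X.cyc i) :
    h.1 ∈ X.edges :=
  mem_edges_of_count X.count_eq hi

theorem nodup (X : RibbonGraph n) (i : Fin n) : (X.cyc i).Nodup := by
  rw [List.nodup_iff_count_le_one]
  intro h
  have h1 := X.count_eq h
  have h2 : (X.cyc i).count h ≤ ∑ i, (X.cyc i).count h :=
    Finset.single_le_sum (f := fun i => (X.cyc i).count h) (fun _ _ => Nat.zero_le _)
      (Finset.mem_univ i)
  split_ifs at h1 <;> omega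

theorem vertex_unique (X : RibbonGraph n) {h : HalfEdge} {i j : Fin n} (hi : h ∈ X.cyc i)
    (hj : h ∈ X.cyc j) : i = j :=
  vertex_unique_of_count X.count_eq hi hj

theorem exists_vertex (X : RibbonGraph n) {h : HalfEdge} (hh : h.1 ∈ X.edges) :
    ∃ i, h ∈ X.cyc i :=
  exists_vertex_of_count X.count_eq hh

/-- An edge which starts and ends at the same vertex. -/
def IsLoop (X : RibbonGraph n) (e : ℕ) : Prop :=
  ∃ i, (e, false) ∈ X.cyc i ∧ (e, true) ∈ X.cyc i

/-- An isomorphism of the underlying unoriented ribbon graphs: a bijection of the edges, which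
may or may not respect the direction of an edge (`flip`), and a bijection of the vertices, such
that the cyclic orders at the vertices correspond. -/
structure Iso (X Y : RibbonGraph n) where
  edge : ℕ → ℕ
  flip : ℕ → Bool
  vertex : Equiv.Perm (Fin n)
  bijOn : Set.BijOn edge X.edges Y.edges
  cyc : ∀ i, Y.cyc (vertex i) ~r (X.cyc i).map fun h => (edge h.1, xor h.2 (flip h.1))

/-- `1` if the isomorphism preserves the orientation, `-1` if it reverses it: the sign of the
permutation of the numbered vertices times `-1` for each reversed edge. -/
def Iso.sgn {X Y : RibbonGraph n} (φ : Iso X Y) : ℚ :=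
  ((Equiv.Perm.sign φ.vertex : ℤ) : ℚ) * (-1) ^ (X.edges.filter fun e => φ.flip e = true).card

end RibbonGraph

/-- The relations which identify isomorphic oriented ribbon graphs, and `(X, -or)` with
`-(X, or)`. -/
noncomputable def orientationRelations (n : ℕ) : Submodule ℚ (RibbonGraph n →₀ ℚ) :=
  Submodule.span ℚ {z | ∃ (X Y : RibbonGraph n) (φ : RibbonGraph.Iso X Y),
    z = Finsupp.single X 1 - φ.sgn • Finsupp.single Y 1}

/-- The degree `n` part of the ribbon graph complex (the sum over all genera and all numbers of
punctures). -/
abbrev RG (n : ℕ) : Type := (RibbonGraph n →₀ ℚ) ⧸ orientationRelations n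

namespace RibbonGraph

variable {n : ℕ}

/-- The class of an oriented ribbon graph in the ribbon graph complex. -/
noncomputable def toRG (X : RibbonGraph n) : RG n :=
  (orientationRelations n).mkQ (Finsupp.single X 1)

theorem toRG_eq {X Y : RibbonGraph n} (φ : Iso X Y) : X.toRG = φ.sgn • Y.toRG := by
  rw [toRG, toRG, ← map_smul, ← sub_eq_zero, ← map_sub, Submodule.mkQ_apply,
    Submodule.Quotient.mk_eq_zero]
  exact Submodule.subset_span ⟨X, Y, φ, rfl⟩

/-- Renumber the vertices: the vertex `i` gets the number `π i`. -/
def relabel (π : Equiv.Perm (Fin n)) (X : RibbonGraph n) : RibbonGraph n where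
  edges := X.edges
  cyc i := X.cyc (π.symm i)
  count_eq h := by
    rw [← X.count_eq h]
    exact Equiv.sum_comp π.symm fun i => (X.cyc i).count h
  valence i := X.valence _
  pos := X.pos
  connected T hT hc := by
    have h1 := X.connected (π ⁻¹' T) (by
      obtain ⟨i, hi⟩ := hT
      exact ⟨π.symm i, by simpa using hi⟩)
      (fun i j e b hi hj hiT => hc (π i) (π j) e b (by simpa using hi) (by simpa using hj) hiT)
    ext i
    have : π.symm i ∈ π ⁻¹' T := by rw [h1]; trivial
    simpa using this

/-- Contract the edge `e`, which goes from the first vertex to the second one.  The two cyclic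
sequences are spliced, the new vertex comes first and the numbers of the others are shifted
down by one. -/
def contractFirst (X : RibbonGraph (n + 2)) (e : ℕ) (h₀ : (e, false) ∈ X.cyc 0)
    (h₁ : (e, true) ∈ X.cyc 1) : RibbonGraph (n + 1) where
  edges := X.edges.erase e
  cyc := Fin.cons (after (e, false) (X.cyc 0) ++ after (e, true) (X.cyc 1))
    fun j : Fin n => X.cyc j.succ.succ
  count_eq h := by
    have h2 := X.count_eq h
    have h2f := X.count_eq (e, false)
    have h2t := X.count_eq (e, true)
    have he : e ∈ X.edges := X.mem_edges h₀
    have p0 := (perm_cons_after h₀).count_eq h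
    have p1 := (perm_cons_after h₁).count_eq h
    rw [Fin.sum_univ_succ, Fin.sum_univ_succ] at h2
    rw [Fin.sum_univ_succ]
    simp only [Fin.cons_zero, Fin.cons_succ, List.count_append]
    simp only [List.count_cons, beq_iff_eq] at p0 p1
    rw [show (Fin.succ 0 : Fin (n + 2)) = 1 from rfl] at h2
    rw [p0, p1] at h2
    generalize (after (e, false) (X.cyc 0)).count h = c0 at h2 ⊢
    generalize (after (e, true) (X.cyc 1)).count h = c1 at h2 ⊢
    generalize ∑ j : Fin n, (X.cyc j.succ.succ).count h = c2 at h2 ⊢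
    obtain ⟨x, b⟩ := h
    by_cases hx : x = e
    · subst hx
      have h3 : (x, b).1 ∈ X.edges := he
      rw [if_pos h3] at h2
      rw [if_neg (Finset.notMem_erase _ _)]
      cases b
      · rw [if_pos rfl] at h2
        omega
      · rw [if_pos (rfl : (x, true) = (x, true))] at h2
        omega
    · have n0 : ¬ (e, false) = (x, b) := fun h => hx (congrArg Prod.fst h).symm
      have n1 : ¬ (e, true) = (x, b) := fun h => hx (congrArg Prod.fst h).symm
      rw [if_neg n0, if_neg n1] at h2
      simp only [Finset.mem_erase, ne_eq, hx, not_false_eq_true, true_and]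
      dsimp only at h2
      omega
  valence i := by
    have p0 := (perm_cons_after h₀).length_eq
    have p1 := (perm_cons_after h₁).length_eq
    have v0 := X.valence 0
    have v1 := X.valence 1
    simp only [List.length_cons] at p0 p1
    refine Fin.cases ?_ (fun j => ?_) i
    · simp only [Fin.cons_zero, List.length_append]
      omega
    · simpa using X.valence j.succ.succ
  pos := Nat.succ_pos n
  connected T hT hc := by
    set q : Fin (n + 2) → Fin (n + 1) := Fin.cases 0 id with hq
    have q0 : q 0 = 0 := rfl
    have qs : ∀ j, q (Fin.succ j) = j := fun j => rfl
    have hmem : ∀ (i : Fin (n + 2)) (h : HalfEdge), h.1 ≠ e → h ∈ X.cyc i →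
        h ∈ (Fin.cons (after (e, false) (X.cyc 0) ++ after (e, true) (X.cyc 1))
          (fun j : Fin n => X.cyc j.succ.succ) : Fin (n + 1) → List HalfEdge) (q i) := by
      intro i h hne
      have m0 := (perm_cons_after h₀).mem_iff (a := h)
      have m1 := (perm_cons_after h₁).mem_iff (a := h)
      have n0 : h ≠ (e, false) := fun hh => hne (by rw [hh])
      have n1 : h ≠ (e, true) := fun hh => hne (by rw [hh])
      simp only [List.mem_cons, n0, n1, false_or] at m0 m1
      refine Fin.cases ?_ (fun j => ?_) i
      · intro hi
        rw [q0, Fin.cons_zero, List.mem_append]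
        exact Or.inl (m0.1 hi)
      · rw [qs]
        refine Fin.cases ?_ (fun j => ?_) j
        · intro hi
          rw [Fin.cons_zero, List.mem_append]
          exact Or.inr (m1.1 hi)
        · intro hi
          rw [Fin.cons_succ]
          exact hi
    have h1 := X.connected (q ⁻¹' T) (by
      obtain ⟨i, hi⟩ := hT
      exact ⟨i.succ, by simpa [qs] using hi⟩) (by
      intro i j x b hi hj hiT
      by_cases hx : x = e
      · subst hx
        have : ∀ m c, (x, c) ∈ X.cyc m → q m = 0 := by
          intro m c hm
          cases c
          · rw [X.vertex_unique hm h₀, q0]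
          · rw [X.vertex_unique hm h₁]; rfl
        rw [Set.mem_preimage, this i b hi] at hiT
        rw [Set.mem_preimage, this j _ hj]
        exact hiT
      · exact hc (q i) (q j) x b (hmem i (x, b) hx hi) (hmem j (x, !b) hx hj) hiT)
    ext i
    have : i.succ ∈ q ⁻¹' T := by rw [h1]; trivial
    simpa [qs] using this

/-- A renumbering of the vertices for which `a` comes first and `b` comes second. -/
def bringToFront (a b : Fin (n + 2)) : Equiv.Perm (Fin (n + 2)) :=
  Equiv.swap 1 (Equiv.swap 0 a b) * Equiv.swap 0 a

theorem bringToFront_left {a b : Fin (n + 2)} (hab : a ≠ b) : bringToFront a b a = 0 := by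
  have h1 : Equiv.swap 0 a b ≠ 0 := by
    intro h
    rw [Equiv.swap_apply_eq_iff, Equiv.swap_apply_left] at h
    exact hab h.symm
  simp only [bringToFront, Equiv.Perm.mul_apply, Equiv.swap_apply_right]
  exact Equiv.swap_apply_of_ne_of_ne (by simp) h1.symm

theorem bringToFront_right (a b : Fin (n + 2)) : bringToFront a b b = 1 := by
  simp [bringToFront]

theorem mem_relabel_left (X : RibbonGraph (n + 2)) {a b : Fin (n + 2)} (hab : a ≠ b)
    {h : HalfEdge} (ha : h ∈ X.cyc a) : h ∈ (X.relabel (bringToFront a b)).cyc 0 := by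
  change _ ∈ X.cyc ((bringToFront a b).symm 0)
  rwa [← bringToFront_left hab, Equiv.symm_apply_apply]

theorem mem_relabel_right (X : RibbonGraph (n + 2)) {a b : Fin (n + 2)}
    {h : HalfEdge} (hb : h ∈ X.cyc b) : h ∈ (X.relabel (bringToFront a b)).cyc 1 := by
  change _ ∈ X.cyc ((bringToFront a b).symm 1)
  rwa [← bringToFront_right a b, Equiv.symm_apply_apply]

/-- Contract the edge `e` from the vertex `a` to the vertex `b`, after the renumbering of the
vertices which makes it an edge from the first vertex to the second one. -/
def contract : {n : ℕ} → (X : RibbonGraph n) → (e : ℕ) → (a b : Fin n) → a ≠ b →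
    (e, false) ∈ X.cyc a → (e, true) ∈ X.cyc b → RibbonGraph (n - 1)
  | 0, _, _, a, _, _, _, _ => a.elim0
  | 1, _, _, a, b, hab, _, _ => absurd (Subsingleton.elim a b) hab
  | _ + 2, X, e, a, b, hab, ha, hb =>
    contractFirst (X.relabel (bringToFront a b)) e
      (mem_relabel_left X hab ha) (mem_relabel_right X hb)

/-- The sign by which the renumbering used in `contract` changes the orientation. -/
def contractSign : {n : ℕ} → (a b : Fin n) → ℚ
  | 0, _, _ => 1
  | 1, _, _ => 1
  | _ + 2, a, b => ((Equiv.Perm.sign (bringToFront a b) : ℤ) : ℚ)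

open Classical in
/-- The contribution of the edge `e` to the boundary of `X`: the oriented graph obtained by
contracting `e` if `e` is not a loop, and zero if it is one. -/
noncomputable def contraction (X : RibbonGraph n) (e : ℕ) : RG (n - 1) :=
  if h : ∃ p : Fin n × Fin n, p.1 ≠ p.2 ∧ (e, false) ∈ X.cyc p.1 ∧ (e, true) ∈ X.cyc p.2 then
    contractSign h.choose.1 h.choose.2 •
      (X.contract e h.choose.1 h.choose.2 h.choose_spec.1 h.choose_spec.2.1
        h.choose_spec.2.2).toRG
  else 0

theorem contraction_eq (X : RibbonGraph n) {e : ℕ} {a b : Fin n} (hab : a ≠ b)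
    (ha : (e, false) ∈ X.cyc a) (hb : (e, true) ∈ X.cyc b) :
    X.contraction e = contractSign a b • (X.contract e a b hab ha hb).toRG := by
  have h : ∃ p : Fin n × Fin n, p.1 ≠ p.2 ∧ (e, false) ∈ X.cyc p.1 ∧ (e, true) ∈ X.cyc p.2 :=
    ⟨(a, b), hab, ha, hb⟩
  have key : ∀ (a' b' : Fin n) (hab' : a' ≠ b') (ha' : (e, false) ∈ X.cyc a')
      (hb' : (e, true) ∈ X.cyc b'), contractSign a' b' • (X.contract e a' b' hab' ha' hb').toRG =
        contractSign a b • (X.contract e a b hab ha hb).toRG := by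
    intro a' b' hab' ha' hb'
    obtain rfl := X.vertex_unique ha' ha
    obtain rfl := X.vertex_unique hb' hb
    rfl
  rw [contraction, dif_pos h]
  exact key _ _ _ _ _

theorem contraction_of_eq (X : RibbonGraph n) {e : ℕ} {a : Fin n}
    (ha : (e, false) ∈ X.cyc a) (hb : (e, true) ∈ X.cyc a) : X.contraction e = 0 := by
  rw [contraction, dif_neg]
  rintro ⟨p, hp, h1, h2⟩
  exact hp ((X.vertex_unique h1 ha).trans (X.vertex_unique h2 hb).symm)

/-! ### The boundary operator respects the relations -/

section WellDefined

theorem after_map {X Y : RibbonGraph n} {Φ : HalfEdge → HalfEdge} {i j : Fin n}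
    (hr : Y.cyc j ~r (X.cyc i).map Φ) {h : HalfEdge} (hi : h ∈ X.cyc i) :
    after (Φ h) (Y.cyc j) = (after h (X.cyc i)).map Φ := by
  refine after_eq (Y.nodup j) (hr.mem_iff.2 (List.mem_map_of_mem hi)) (hr.trans ?_)
  exact (isRotated_cons_after hi).map Φ

/-- The permutation of the remaining vertices when the first two vertices are merged. -/
theorem exists_merged_perm (θ : Equiv.Perm (Fin (n + 2))) (h0 : θ 0 = 0) (h1 : θ 1 = 1) :
    ∃ ρ : Equiv.Perm (Fin (n + 1)), ρ 0 = 0 ∧ (∀ j : Fin n, θ j.succ.succ = (ρ j.succ).succ) ∧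
      Equiv.Perm.sign ρ = Equiv.Perm.sign θ := by
  obtain ⟨⟨p, ρ⟩, hρ⟩ := Equiv.Perm.decomposeFin.symm.surjective θ
  have hp : p = 0 := by
    rw [← h0, ← hρ, Equiv.Perm.decomposeFin_symm_apply_zero]
  subst hp
  have hs : ∀ j, θ (Fin.succ j) = (ρ j).succ := by
    intro j
    rw [← hρ, Equiv.Perm.decomposeFin_symm_apply_succ]
    simp
  refine ⟨ρ, ?_, fun j => hs j.succ, ?_⟩
  · have := hs 0
    rw [show (Fin.succ 0 : Fin (n + 2)) = 1 from rfl, h1] at this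
    exact (Fin.succ_injective _ this.symm)
  · rw [← hρ, Equiv.Perm.decomposeFin.symm_sign]
    simp

theorem contractFirst_iso {X Y : RibbonGraph (n + 2)} (φ : Iso X Y) {e : ℕ}
    {h₀ : (e, false) ∈ X.cyc 0} {h₁ : (e, true) ∈ X.cyc 1}
    {h₀' : (φ.edge e, false) ∈ Y.cyc 0} {h₁' : (φ.edge e, true) ∈ Y.cyc 1} :
    (X.contractFirst e h₀ h₁).toRG =
      φ.sgn • (Y.contractFirst (φ.edge e) h₀' h₁').toRG := by
  set Φ : HalfEdge → HalfEdge := fun h => (φ.edge h.1, xor h.2 (φ.flip h.1)) with hΦ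
  have he : e ∈ X.edges := X.mem_edges h₀
  have m0 : (φ.edge e, xor false (φ.flip e)) ∈ Y.cyc (φ.vertex 0) :=
    (φ.cyc 0).mem_iff.2 (List.mem_map_of_mem (f := Φ) h₀)
  have m1 : (φ.edge e, xor true (φ.flip e)) ∈ Y.cyc (φ.vertex 1) :=
    (φ.cyc 1).mem_iff.2 (List.mem_map_of_mem (f := Φ) h₁)
  have hbij : Set.BijOn φ.edge (X.edges.erase e : Finset ℕ)
      (Y.edges.erase (φ.edge e) : Finset ℕ) := by
    simp only [Finset.coe_erase]
    exact φ.bijOn.sdiff_singleton he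
  have hcard : (X.edges.filter fun e => φ.flip e = true).card =
      ((X.edges.erase e).filter fun e => φ.flip e = true).card +
        if φ.flip e = true then 1 else 0 := by
    rw [Finset.filter_erase]
    split_ifs with hf
    · rw [Finset.card_erase_add_one]
      simp [he, hf]
    · rw [Finset.erase_eq_of_notMem, add_zero]
      simp [hf]
  have a0 := after_map (Φ := Φ) (φ.cyc 0) h₀
  have a1 := after_map (Φ := Φ) (φ.cyc 1) h₁
  cases hf : φ.flip e
  · simp only [hΦ, hf, Bool.xor_false] at m0 m1 a0 a1
    have v0 := Y.vertex_unique m0 h₀'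
    have v1 := Y.vertex_unique m1 h₁'
    rw [v0] at a0
    rw [v1] at a1
    obtain ⟨ρ, r0, rs, rsgn⟩ := exists_merged_perm φ.vertex v0 v1
    let ψ : Iso (X.contractFirst e h₀ h₁) (Y.contractFirst (φ.edge e) h₀' h₁') :=
      { edge := φ.edge
        flip := φ.flip
        vertex := ρ
        bijOn := hbij
        cyc := by
          refine Fin.cases ?_ (fun j => ?_)
          · rw [r0]
            simp only [contractFirst, Fin.cons_zero, a0, a1, List.map_append]
            exact List.IsRotated.refl _
          · have := φ.cyc j.succ.succ
            rw [rs] at this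
            obtain ⟨m, hm⟩ : ∃ m, ρ j.succ = Fin.succ m := by
              refine (Fin.exists_succ_eq.2 fun h => ?_).imp fun _ h => h.symm
              rw [← r0] at h
              exact Fin.succ_ne_zero _ (ρ.injective h)
            rw [hm] at this ⊢
            exact this }
    rw [toRG_eq ψ]
    congr 1
    simp only [Iso.sgn, ψ, rsgn, hcard, hf]
    simp [contractFirst]
  · simp only [hΦ, hf, Bool.xor_true, Bool.not_false, Bool.not_true] at m0 m1 a0 a1
    have v0 := Y.vertex_unique m0 h₁'
    have v1 := Y.vertex_unique m1 h₀'
    rw [v0] at a0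
    rw [v1] at a1
    obtain ⟨ρ, r0, rs, rsgn⟩ := exists_merged_perm (Equiv.swap 0 1 * φ.vertex)
      (by simp [v0]) (by simp [v1])
    let ψ : Iso (X.contractFirst e h₀ h₁) (Y.contractFirst (φ.edge e) h₀' h₁') :=
      { edge := φ.edge
        flip := φ.flip
        vertex := ρ
        bijOn := hbij
        cyc := by
          refine Fin.cases ?_ (fun j => ?_)
          · rw [r0]
            simp only [contractFirst, Fin.cons_zero, a0, a1, List.map_append]
            exact List.isRotated_append
          · have := φ.cyc j.succ.succ
            obtain ⟨m, hm⟩ : ∃ m, ρ j.succ = Fin.succ m := by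
              refine (Fin.exists_succ_eq.2 fun h => ?_).imp fun _ h => h.symm
              rw [← r0] at h
              exact Fin.succ_ne_zero _ (ρ.injective h)
            have hrs := rs j
            have hne : (m.succ.succ : Fin (n + 2)) ≠ 1 := fun h =>
              Fin.succ_ne_zero m (Fin.succ_injective _ h)
            rw [hm, Equiv.Perm.mul_apply, Equiv.swap_apply_eq_iff,
              Equiv.swap_apply_of_ne_of_ne (Fin.succ_ne_zero _) hne] at hrs
            rw [hrs] at this
            rw [hm]
            exact this }
    rw [toRG_eq ψ]
    congr 1
    simp only [Iso.sgn, ψ, rsgn, hcard, hf, Equiv.Perm.sign_mul,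
      Equiv.Perm.sign_swap (Fin.zero_ne_one (n := n))]
    simp [contractFirst, pow_succ]

/-- The isomorphism between renumbered graphs induced by an isomorphism. -/
def Iso.relabel {X Y : RibbonGraph n} (φ : Iso X Y) (π τ : Equiv.Perm (Fin n)) :
    Iso (X.relabel π) (Y.relabel τ) where
  edge := φ.edge
  flip := φ.flip
  vertex := τ * φ.vertex * π⁻¹
  bijOn := φ.bijOn
  cyc i := by
    have := φ.cyc (π.symm i)
    simpa [RibbonGraph.relabel] using this

theorem perm_sign_mul_self (π : Equiv.Perm (Fin n)) :
    (((Equiv.Perm.sign π : ℤˣ) : ℤ) : ℚ) * (((Equiv.Perm.sign π : ℤˣ) : ℤ) : ℚ) = 1 := by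
  exact_mod_cast Int.units_coe_mul_self _

theorem Iso.sgn_relabel {X Y : RibbonGraph n} (φ : Iso X Y) (π τ : Equiv.Perm (Fin n)) :
    (φ.relabel π τ).sgn = ((Equiv.Perm.sign τ : ℤ) : ℚ) * φ.sgn *
      ((Equiv.Perm.sign π : ℤ) : ℚ) := by
  have h : (φ.relabel π τ).sgn = ((Equiv.Perm.sign (τ * φ.vertex * π⁻¹) : ℤ) : ℚ) *
      (-1) ^ (X.edges.filter fun e => φ.flip e = true).card := rfl
  rw [h, Iso.sgn, Equiv.Perm.sign_mul, Equiv.Perm.sign_mul, Equiv.Perm.sign_inv]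
  push_cast
  ring

/-- An isomorphism carries the contribution of an edge to the contribution of its image. -/
theorem contraction_iso {X Y : RibbonGraph n} (φ : Iso X Y) {e : ℕ} (he : e ∈ X.edges) :
    X.contraction e = φ.sgn • Y.contraction (φ.edge e) := by
  obtain ⟨a, ha⟩ := X.exists_vertex (h := (e, false)) he
  obtain ⟨b, hb⟩ := X.exists_vertex (h := (e, true)) he
  have ma : (φ.edge e, xor false (φ.flip e)) ∈ Y.cyc (φ.vertex a) :=
    (φ.cyc a).mem_iff.2 (List.mem_map_of_mem
      (f := fun h : HalfEdge => (φ.edge h.1, xor h.2 (φ.flip h.1))) ha)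
  have mb : (φ.edge e, xor true (φ.flip e)) ∈ Y.cyc (φ.vertex b) :=
    (φ.cyc b).mem_iff.2 (List.mem_map_of_mem
      (f := fun h : HalfEdge => (φ.edge h.1, xor h.2 (φ.flip h.1))) hb)
  obtain ⟨a', b', ha', hb', hab'⟩ : ∃ a' b', (φ.edge e, false) ∈ Y.cyc a' ∧
      (φ.edge e, true) ∈ Y.cyc b' ∧ (a' = b' ↔ a = b) := by
    cases hf : φ.flip e
    · rw [hf] at ma mb
      exact ⟨_, _, ma, mb, φ.vertex.injective.eq_iff⟩
    · rw [hf] at ma mb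
      exact ⟨_, _, mb, ma, φ.vertex.injective.eq_iff.trans eq_comm⟩
  by_cases hab : a = b
  · have hab2 := hab'.2 hab
    subst hab hab2
    rw [contraction_of_eq X ha hb, contraction_of_eq Y ha' hb', smul_zero]
  · have hab2 : a' ≠ b' := fun h => hab (hab'.1 h)
    rw [contraction_eq X hab ha hb, contraction_eq Y hab2 ha' hb']
    match n, X, Y, φ, a, b, hab, ha, hb, a', b', hab2, ha', hb' with
    | 0, _, _, _, a, _, _, _, _, _, _, _, _, _ => exact a.elim0
    | 1, _, _, _, a, b, hab, _, _, _, _, _, _, _ => exact absurd (Subsingleton.elim a b) hab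
    | n + 2, X, Y, φ, a, b, hab, ha, hb, a', b', hab2, ha', hb' =>
      simp only [contract, contractSign]
      rw [contractFirst_iso (φ.relabel (bringToFront a b) (bringToFront a' b'))
        (h₀' := mem_relabel_left Y hab2 ha') (h₁' := mem_relabel_right Y hb'), smul_smul,
        smul_smul, Iso.sgn_relabel]
      congr 1
      have := perm_sign_mul_self (bringToFront a b)
      linear_combination (φ.sgn * ((Equiv.Perm.sign (bringToFront a' b') : ℤ) : ℚ)) * this

end WellDefined

/-- The sum of the graphs obtained by contracting each non-loop edge. -/
noncomputable def boundary (X : RibbonGraph n) : RG (n - 1) :=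
  ∑ e ∈ X.edges, X.contraction e

theorem boundary_iso {X Y : RibbonGraph n} (φ : Iso X Y) :
    X.boundary = φ.sgn • Y.boundary := by
  rw [boundary, boundary, Finset.smul_sum]
  refine Finset.sum_bij (fun e _ => φ.edge e) (fun e he => φ.bijOn.mapsTo he)
    (fun e he f hf h => φ.bijOn.injOn he hf h) (fun f hf => ?_)
    (fun e he => contraction_iso φ he)
  obtain ⟨e, he, rfl⟩ := φ.bijOn.surjOn hf
  exact ⟨e, he, rfl⟩

end RibbonGraph

/-- The boundary operator of the ribbon graph complex. -/
noncomputable def boundaryMap (n : ℕ) : RG n →ₗ[ℚ] RG (n - 1) :=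
  (orientationRelations n).liftQ (Finsupp.linearCombination ℚ RibbonGraph.boundary) <| by
    rw [orientationRelations, Submodule.span_le]
    rintro _ ⟨X, Y, φ, rfl⟩
    simp only [SetLike.mem_coe, LinearMap.mem_ker, map_sub, map_smul,
      Finsupp.linearCombination_single, one_smul]
    rw [RibbonGraph.boundary_iso φ, sub_self]

theorem boundaryMap_toRG {n : ℕ} (X : RibbonGraph n) :
    boundaryMap n X.toRG = X.boundary := by
  rw [boundaryMap, RibbonGraph.toRG, Submodule.mkQ_apply, Submodule.liftQ_apply]
  simp

/-! ### Cut vertices and the reduced complex -/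

namespace RibbonGraph

variable {n : ℕ}

/-- There is a cut vertex.  A properly embedded arc through the vertex `v` divides the cyclic
sequence of half-edges at `v` into two intervals `A` and `B` (nonempty, as the arc would
otherwise cut off nothing of the graph).  It disconnects the thickened surface exactly when the
graph falls apart after `v` is split into a vertex with the half-edges `A` and another with the
half-edges `B`: the edges on the side of `A` form a set `S`, and only at `v` do edges of
both sides meet. -/
def HasCutVertex (X : RibbonGraph n) : Prop :=
  ∃ (v : Fin n) (A B : List HalfEdge) (S : Set ℕ),
    X.cyc v ~r A ++ B ∧ A ≠ [] ∧ B ≠ [] ∧ (∀ h ∈ A, h.1 ∈ S) ∧ (∀ h ∈ B, h.1 ∉ S) ∧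
      ∀ i, i ≠ v → (∀ h ∈ X.cyc i, h.1 ∈ S) ∨ (∀ h ∈ X.cyc i, h.1 ∉ S)

theorem HasCutVertex.relabel {X : RibbonGraph n} (hX : X.HasCutVertex)
    (π : Equiv.Perm (Fin n)) : (X.relabel π).HasCutVertex := by
  obtain ⟨v, A, B, S, hv, hA, hB, hAS, hBS, hS⟩ := hX
  refine ⟨π v, A, B, S, by simpa [RibbonGraph.relabel] using hv, hA, hB, hAS, hBS,
    fun i hi => hS (π.symm i) fun h => hi ?_⟩
  rw [← h, Equiv.apply_symm_apply]

theorem mem_of_mem_after {h x : HalfEdge} {l : List HalfEdge} (hl : h ∈ l)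
    (hx : x ∈ after h l) : x ∈ l :=
  (perm_cons_after hl).mem_iff.2 (List.mem_cons_of_mem _ hx)

theorem after_ne_nil (X : RibbonGraph n) {h : HalfEdge} {i : Fin n} (hi : h ∈ X.cyc i) :
    after h (X.cyc i) ≠ [] := by
  intro h0
  have h1 := (perm_cons_after hi).length_eq
  have h2 := X.valence i
  rw [h0] at h1
  simp at h1
  omega

/-- The effect of splicing a cyclic sequence `C` with edges in `S` into the side `P`. -/
theorem exists_split {l P Q C : List HalfEdge} {S : Set ℕ} {h : HalfEdge} (hn : l.Nodup)
    (hl : l ~r P ++ Q) (hQ : Q ≠ []) (hPS : ∀ x ∈ P, x.1 ∈ S)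
    (hQS : ∀ x ∈ Q, x.1 ∉ S) (hC : C ≠ []) (hCS : ∀ x ∈ C, x.1 ∈ S) (hh : h ∈ l)
    (hS : h.1 ∈ S) :
    ∃ P' Q' : List HalfEdge, after h l ++ C ~r P' ++ Q' ∧ P' ≠ [] ∧ Q' ≠ [] ∧
      (∀ x ∈ P', x.1 ∈ S) ∧ (∀ x ∈ Q', x.1 ∉ S) := by
  have hP : h ∈ P := by
    rcases List.mem_append.1 (hl.mem_iff.1 hh) with h1 | h1
    · exact h1
    · exact absurd hS (hQS h h1)
  obtain ⟨P₁, P₂, rfl⟩ := List.append_of_mem hP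
  have h1 : after h l = P₂ ++ Q ++ P₁ := by
    refine after_eq hn hh (hl.trans ?_)
    have : P₁ ++ h :: P₂ ++ Q ~r (h :: P₂ ++ Q) ++ P₁ := by
      rw [List.append_assoc]
      exact List.isRotated_append
    simpa using this
  refine ⟨P₁ ++ C ++ P₂, Q, ?_, by simp [hC], hQ, ?_, hQS⟩
  · rw [h1]
    have : (P₂ ++ Q) ++ (P₁ ++ C) ~r (P₁ ++ C) ++ (P₂ ++ Q) := List.isRotated_append
    simpa using this
  · intro x hx
    simp only [List.mem_append] at hx
    rcases hx with (hx | hx) | hx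
    · exact hPS x (by simp [hx])
    · exact hCS x hx
    · exact hPS x (by simp [hx])

theorem HasCutVertex.contractFirst {X : RibbonGraph (n + 2)} (hX : X.HasCutVertex) {e : ℕ}
    (h₀ : (e, false) ∈ X.cyc 0) (h₁ : (e, true) ∈ X.cyc 1) :
    (X.contractFirst e h₀ h₁).HasCutVertex := by
  obtain ⟨v, A, B, S, hv, hA, hB, hAS, hBS, hS, heS⟩ : ∃ (v : Fin (n + 2))
      (A B : List HalfEdge) (S : Set ℕ), X.cyc v ~r A ++ B ∧ A ≠ [] ∧ B ≠ [] ∧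
      (∀ h ∈ A, h.1 ∈ S) ∧ (∀ h ∈ B, h.1 ∉ S) ∧
      (∀ i, i ≠ v → (∀ h ∈ X.cyc i, h.1 ∈ S) ∨ (∀ h ∈ X.cyc i, h.1 ∉ S)) ∧ e ∈ S := by
    obtain ⟨v, A, B, S, hv, hA, hB, hAS, hBS, hS⟩ := hX
    by_cases he : e ∈ S
    · exact ⟨v, A, B, S, hv, hA, hB, hAS, hBS, hS, he⟩
    · refine ⟨v, B, A, Sᶜ, hv.trans List.isRotated_append, hB, hA, hBS,
        fun h hh hn => hn (hAS h hh), fun i hi => ?_, he⟩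
      rcases hS i hi with h | h
      · exact Or.inr fun x hx hn => hn (h x hx)
      · exact Or.inl h
  have hfull : ∀ i b, i ≠ v → (e, b) ∈ X.cyc i → ∀ h ∈ X.cyc i, h.1 ∈ S := by
    intro i b hi hb
    rcases hS i hi with h | h
    · exact h
    · exact absurd heS (h _ hb)
  have h01 : (0 : Fin (n + 2)) ≠ 1 := Fin.zero_ne_one
  by_cases hv0 : v = 0
  · subst hv0
    obtain ⟨P, Q, hr, hP, hQ, hPS, hQS⟩ := exists_split (X.nodup 0) hv hB hAS hBS
      (X.after_ne_nil h₁) (fun x hx => hfull 1 true h01.symm h₁ x (mem_of_mem_after h₁ hx))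
      h₀ heS
    refine ⟨0, P, Q, S, by simpa [RibbonGraph.contractFirst] using hr, hP, hQ, hPS, hQS,
      Fin.cases (fun h => absurd rfl h) fun j _ => ?_⟩
    simpa [RibbonGraph.contractFirst] using hS j.succ.succ (Fin.succ_ne_zero _)
  by_cases hv1 : v = 1
  · subst hv1
    obtain ⟨P, Q, hr, hP, hQ, hPS, hQS⟩ := exists_split (X.nodup 1) hv hB hAS hBS
      (X.after_ne_nil h₀) (fun x hx => hfull 0 false h01 h₀ x (mem_of_mem_after h₀ hx))
      h₁ heS
    refine ⟨0, P, Q, S, ?_, hP, hQ, hPS, hQS,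
      Fin.cases (fun h => absurd rfl h) fun j _ => ?_⟩
    · simp only [RibbonGraph.contractFirst, Fin.cons_zero]
      exact List.isRotated_append.trans hr
    · simpa [RibbonGraph.contractFirst] using hS j.succ.succ
        fun h => Fin.succ_ne_zero j (Fin.succ_injective _ h)
  · obtain ⟨w, rfl⟩ := Fin.exists_succ_eq.2 hv0
    obtain ⟨u, rfl⟩ := Fin.exists_succ_eq.2 fun h : w = 0 => hv1 (by rw [h]; rfl)
    refine ⟨u.succ, A, B, S, by simpa [RibbonGraph.contractFirst] using hv, hA, hB, hAS, hBS,
      Fin.cases (fun _ => Or.inl fun h hh => ?_) fun j hj => ?_⟩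
    · simp only [RibbonGraph.contractFirst, Fin.cons_zero, List.mem_append] at hh
      rcases hh with hh | hh
      · exact hfull 0 false (Ne.symm hv0) h₀ h (mem_of_mem_after h₀ hh)
      · exact hfull 1 true (Ne.symm hv1) h₁ h (mem_of_mem_after h₁ hh)
    · simpa [RibbonGraph.contractFirst] using hS j.succ.succ
        fun h => hj (Fin.succ_injective _ h)

theorem HasCutVertex.contract {X : RibbonGraph n} (hX : X.HasCutVertex) {e : ℕ} {a b : Fin n}
    (hab : a ≠ b) (ha : (e, false) ∈ X.cyc a) (hb : (e, true) ∈ X.cyc b) :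
    (X.contract e a b hab ha hb).HasCutVertex := by
  match n, X, hX, a, b, hab, ha, hb with
  | 0, _, _, a, _, _, _, _ => exact a.elim0
  | 1, _, _, a, b, hab, _, _ => exact absurd (Subsingleton.elim a b) hab
  | n + 2, X, hX, a, b, hab, ha, hb =>
    exact (hX.relabel _).contractFirst (mem_relabel_left X hab ha) (mem_relabel_right X hb)

end RibbonGraph

/-- The subspace spanned by the graphs with cut vertices. -/
noncomputable def cutSubspace (n : ℕ) : Submodule ℚ (RG n) :=
  Submodule.span ℚ {z | ∃ X : RibbonGraph n, X.HasCutVertex ∧ z = X.toRG}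

theorem cutSubspace_le_comap (n : ℕ) :
    cutSubspace n ≤ (cutSubspace (n - 1)).comap (boundaryMap n) := by
  rw [cutSubspace, Submodule.span_le]
  rintro _ ⟨X, hX, rfl⟩
  rw [SetLike.mem_coe, Submodule.mem_comap, boundaryMap_toRG, RibbonGraph.boundary]
  refine Submodule.sum_mem _ fun e he => ?_
  rw [RibbonGraph.contraction]
  split_ifs with h
  · exact Submodule.smul_mem _ _ (Submodule.subset_span ⟨_, hX.contract _ _ _, rfl⟩)
  · exact Submodule.zero_mem _

/-- The degree `n` part of the reduced ribbon graph complex. -/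
abbrev ReducedRG (n : ℕ) : Type := RG n ⧸ cutSubspace n

/-- The projection of the ribbon graph complex to the reduced ribbon graph complex. -/
noncomputable def reduce (n : ℕ) : RG n →ₗ[ℚ] ReducedRG n := (cutSubspace n).mkQ

/-- The boundary operator of the reduced ribbon graph complex. -/
noncomputable def reducedBoundaryMap (n : ℕ) : ReducedRG n →ₗ[ℚ] ReducedRG (n - 1) :=
  (cutSubspace n).mapQ (cutSubspace (n - 1)) (boundaryMap n) (cutSubspace_le_comap n)

/-! ### Ornate necklaces -/

namespace Necklace

open BinaryTree

/-- Planar binary rooted trees: `nil` is the tree with one leaf and no internal vertex. -/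
abbrev PlanarTree : Type := BinaryTree Unit

/- A necklace with `k` leaves in total has `k` vertices, numbered by `0, …, k - 1`: the root of
each tree and then its internal vertices from left to right, one tree after the other.  A tree
with root number `s` and `i` leaves has the internal vertices `s + 1, …, s + i - 1` and the
leaves `s, …, s + i - 1`; the internal vertex `m` lies between the leaves `m - 1` and `m`. -/

/-- The edge of the large loop which leaves the root with number `s`. -/
def loopEdge (s : ℕ) : ℕ := 2 * s

/-- The tree edge which enters the internal vertex `m` from below. -/
def nodeEdge (m : ℕ) : ℕ := 2 * m

/-- The tree edge which emanates from the top of a tree at the leaf `u`. -/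
def leafEdge (u : ℕ) : ℕ := 2 * u + 1

/-- The lowest edge of the tree `t` with root number `s`. -/
def rootEdge : PlanarTree → ℕ → ℕ
  | nil, s => leafEdge s
  | node _ l _, s => nodeEdge (s + l.numLeaves)

/-- The cyclic sequences at the internal vertices of the tree with root number `s`, from left to
right: the edge from below, the edge to the right child, the edge to the left child. -/
def nodeCycles : PlanarTree → ℕ → List (List HalfEdge)
  | nil, _ => []
  | node _ l r, s =>
    nodeCycles l s ++
      [(nodeEdge (s + l.numLeaves), true), (rootEdge r (s + l.numLeaves), false),
        (rootEdge l s, false)] ::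
      nodeCycles r (s + l.numLeaves)

/-- The cyclic sequence at the root of the tree `t` with number `s`, where `p` is the number of
the preceding root: the outgoing edge of the large loop, the lowest edge of the tree, the
incoming edge of the large loop and, on the other side of the large loop, the edges from the
tops of the tree, which arrive as parallel strands from left to right. -/
def rootCycle (p s : ℕ) (t : PlanarTree) : List HalfEdge :=
  (loopEdge s, false) :: (rootEdge t s, false) :: (loopEdge p, true) ::
    (List.range' s t.numLeaves).map fun u => (leafEdge u, true)

/-- The cyclic sequences at the vertices of the trees `ts`, where `s` is the first root number
and `p` is the number of the preceding root. -/
def cycles : ℕ → ℕ → List PlanarTree → List (List HalfEdge)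
  | _, _, [] => []
  | p, s, t :: ts => (rootCycle p s t :: nodeCycles t s) ++ cycles s (s + t.numLeaves) ts

/-- The number of the last root (or `p` if there is no tree). -/
def lastRoot : ℕ → ℕ → List PlanarTree → ℕ
  | p, _, [] => p
  | _, s, t :: ts => lastRoot s (s + t.numLeaves) ts

/-- The total number of leaves. -/
def leaves (ts : List PlanarTree) : ℕ := (ts.map numLeaves).sum

theorem length_nodeCycles (t : PlanarTree) (s : ℕ) :
    (nodeCycles t s).length + 1 = t.numLeaves := by
  induction t generalizing s with
  | nil => rfl
  | node _ l r hl hr =>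
    have h1 := hl s
    have h2 := hr (s + l.numLeaves)
    simp only [nodeCycles, List.length_append, List.length_cons, numLeaves]
    omega

theorem length_cycles (ts : List PlanarTree) (p s : ℕ) :
    (cycles p s ts).length = leaves ts := by
  induction ts generalizing p s with
  | nil => rfl
  | cons t ts ih =>
    have h1 := ih s (s + t.numLeaves)
    have h2 := length_nodeCycles t s
    simp only [cycles, leaves, List.length_append, List.length_cons, List.map_cons,
      List.sum_cons] at h1 ⊢
    omega

theorem three_le_length_nodeCycles (t : PlanarTree) (s : ℕ) :
    ∀ l ∈ nodeCycles t s, 3 ≤ l.length := by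
  induction t generalizing s with
  | nil => simp [nodeCycles]
  | node _ l r hl hr =>
    intro x hx
    simp only [nodeCycles, List.mem_append, List.mem_cons] at hx
    rcases hx with hx | rfl | hx
    · exact hl _ x hx
    · simp
    · exact hr _ x hx

theorem three_le_length_cycles (ts : List PlanarTree) (p s : ℕ) :
    ∀ l ∈ cycles p s ts, 3 ≤ l.length := by
  induction ts generalizing p s with
  | nil => simp [cycles]
  | cons t ts ih =>
    intro x hx
    simp only [cycles, List.mem_append, List.mem_cons] at hx
    rcases hx with (rfl | hx) | hx
    · simp [rootCycle]
    · exact three_le_length_nodeCycles t s x hx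
    · exact ih _ _ x hx

theorem numLeaves_pos' (t : PlanarTree) : 0 < t.numLeaves := by
  have := length_nodeCycles t 0
  omega

theorem count_nodeCycles (t : PlanarTree) (s x : ℕ) (b : Bool) :
    (nodeCycles t s).flatten.count (x, b) + (if x = rootEdge t s ∧ b = false then 1 else 0) =
      (if x % 2 = 0 ∧ s < x / 2 ∧ x / 2 < s + t.numLeaves then 1 else 0) +
      (if b = false ∧ x % 2 = 1 ∧ s ≤ x / 2 ∧ x / 2 < s + t.numLeaves then 1 else 0) := by
  induction t generalizing s with
  | nil =>
    rw [show nodeCycles nil s = [] from rfl, show rootEdge nil s = 2 * s + 1 from rfl,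
      show (nil : PlanarTree).numLeaves = 1 from rfl, List.flatten_nil, List.count_nil]
    cases b <;> simp only [reduceCtorEq, and_true, and_false, true_and, false_and,
      if_false] <;> split_ifs <;> omega
  | node v l r hl hr =>
    have h1 := hl s
    have h2 := hr (s + l.numLeaves)
    have pl := numLeaves_pos' l
    have pr := numLeaves_pos' r
    rw [show rootEdge (node v l r) s = 2 * (s + l.numLeaves) from rfl,
      show (node v l r).numLeaves = l.numLeaves + r.numLeaves from rfl]
    simp only [nodeCycles, List.flatten_append, List.flatten_cons, List.count_append,
      List.count_cons, List.count_nil, nodeEdge, beq_iff_eq, Prod.mk.injEq]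
    clear hl hr
    generalize (nodeCycles l s).flatten.count (x, b) = c1 at *
    generalize (nodeCycles r (s + l.numLeaves)).flatten.count (x, b) = c2 at *
    generalize rootEdge r (s + l.numLeaves) = c3 at *
    generalize rootEdge l s = c4 at *
    generalize numLeaves l = i at *
    generalize numLeaves r = j at *
    cases b <;> simp only [reduceCtorEq, and_true, and_false, true_and, false_and,
      if_false, add_zero, zero_add, @eq_comm _ c3 x, @eq_comm _ c4 x] at *
    · generalize (if x = c3 then 1 else 0) = d3 at *
      generalize (if x = c4 then 1 else 0) = d4 at *
      split_ifs at * <;> omega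
    · split_ifs at * <;> omega

theorem count_leafEdges (s i x : ℕ) (b : Bool) :
    ((List.range' s i).map fun u => ((leafEdge u, true) : HalfEdge)).count (x, b) =
      if b = true ∧ x % 2 = 1 ∧ s ≤ x / 2 ∧ x / 2 < s + i then 1 else 0 := by
  induction i generalizing s with
  | zero =>
    rw [if_neg (by omega)]
    simp
  | succ i ih =>
    rw [List.range'_succ, List.map_cons, List.count_cons, ih]
    clear ih
    simp only [leafEdge, beq_iff_eq, Prod.mk.injEq]
    cases b
    · simp
    · simp only [true_and, and_true]
      split_ifs <;> omega

theorem count_cycles (ts : List PlanarTree) (p s x : ℕ) (b : Bool) :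
    (cycles p s ts).flatten.count (x, b) +
        (if x = 2 * lastRoot p s ts ∧ b = true then 1 else 0) =
      (if x = 2 * p ∧ b = true then 1 else 0) +
      (if 2 * s ≤ x ∧ x < 2 * (s + leaves ts) then 1 else 0) := by
  induction ts generalizing p s with
  | nil =>
    rw [show cycles p s [] = [] from rfl, show lastRoot p s [] = p from rfl,
      show leaves [] = 0 from rfl, List.flatten_nil, List.count_nil,
      if_neg (show ¬ (2 * s ≤ x ∧ x < 2 * (s + 0)) by omega)]
    omega
  | cons t ts ih =>
    have h1 := ih s (s + t.numLeaves)
    have h2 := count_nodeCycles t s x b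
    have h3 := count_leafEdges s t.numLeaves x b
    have pt := numLeaves_pos' t
    have hl : leaves (t :: ts) = t.numLeaves + leaves ts := by simp [leaves]
    rw [hl, show lastRoot p s (t :: ts) = lastRoot s (s + t.numLeaves) ts from rfl]
    simp only [cycles, List.cons_append, List.flatten_cons, List.flatten_append,
      List.count_append, rootCycle, List.count_cons, h3, beq_iff_eq, Prod.mk.injEq, loopEdge]
    clear ih hl h3
    generalize (nodeCycles t s).flatten.count (x, b) = c1 at *
    generalize (cycles s (s + t.numLeaves) ts).flatten.count (x, b) = c2 at *
    generalize rootEdge t s = c3 at *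
    generalize lastRoot s (s + t.numLeaves) ts = r at *
    generalize leaves ts = L at *
    generalize hN : numLeaves t = N at *
    cases b <;> simp only [reduceCtorEq, and_true, and_false, true_and, false_and,
      if_false, add_zero, zero_add, @eq_comm _ c3 x] at *
    · generalize (if x = c3 then 1 else 0) = d3 at *
      split_ifs at * <;> omega
    · generalize (if x = 2 * r then 1 else 0) = d3 at *
      split_ifs at * <;> omega

/-- Two predicates on edges which agree along each vertex of a tree. -/
theorem connected_nodeCycles (Q : ℕ → Prop) (r : Prop) (t : PlanarTree) (s : ℕ)
    (hQ : ∀ l ∈ nodeCycles t s, ∀ h ∈ l, ∀ h' ∈ l, (Q h.1 ↔ Q h'.1))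
    (hr : ∀ u, s ≤ u → u < s + t.numLeaves → (Q (leafEdge u) ↔ r)) :
    (Q (rootEdge t s) ↔ r) ∧ ∀ l ∈ nodeCycles t s, ∀ h ∈ l, (Q h.1 ↔ r) := by
  induction t generalizing s with
  | nil => exact ⟨hr s le_rfl (by simp), by simp [nodeCycles]⟩
  | node _ a b ha hb =>
    simp only [nodeCycles, List.mem_append, List.mem_cons, numLeaves] at hQ hr
    obtain ⟨h1, h2⟩ := ha s (fun l hl => hQ l (Or.inl hl)) fun u h3 h4 => hr u h3 (by omega)
    obtain ⟨h3, h4⟩ := hb (s + a.numLeaves) (fun l hl => hQ l (Or.inr (Or.inr hl)))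
      fun u h5 h6 => hr u (by omega) (by omega)
    have h5 := hQ _ (Or.inr (Or.inl rfl))
    have h6 := h5 (nodeEdge (s + a.numLeaves), true) (by simp) (rootEdge a s, false) (by simp)
    refine ⟨h6.trans h1, ?_⟩
    intro l hl h hh
    simp only [nodeCycles, List.mem_append, List.mem_cons] at hl
    rcases hl with hl | rfl | hl
    · exact h2 l hl h hh
    · exact (h5 h hh (rootEdge a s, false) (by simp)).trans h1
    · exact h4 l hl h hh

theorem connected_cycles (Q : ℕ → Prop) (ts : List PlanarTree) (p s : ℕ)
    (hQ : ∀ l ∈ cycles p s ts, ∀ h ∈ l, ∀ h' ∈ l, (Q h.1 ↔ Q h'.1)) :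
    ∀ l ∈ cycles p s ts, ∀ h ∈ l, (Q h.1 ↔ Q (loopEdge p)) := by
  induction ts generalizing p s with
  | nil => simp [cycles]
  | cons t ts ih =>
    simp only [cycles, List.mem_append, List.mem_cons] at hQ
    have h0 := hQ _ (Or.inl (Or.inl rfl))
    have h1 : ∀ h ∈ rootCycle p s t, (Q h.1 ↔ Q (loopEdge p)) := fun h hh =>
      h0 h hh (loopEdge p, true) (by simp [rootCycle])
    have h2 := (connected_nodeCycles Q (Q (loopEdge p)) t s
      (fun l hl => hQ l (Or.inl (Or.inr hl))) fun u hu hu' =>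
        h1 (leafEdge u, true) (by simp [rootCycle, leafEdge]; omega)).2
    have h3 := ih s (s + t.numLeaves) fun l hl => hQ l (Or.inr hl)
    have h4 := h1 (loopEdge s, false) (by simp [rootCycle])
    intro l hl h hh
    simp only [cycles, List.mem_append, List.mem_cons] at hl
    rcases hl with (rfl | hl) | hl
    · exact h1 h hh
    · exact h2 l hl h hh
    · exact (h3 l hl h hh).trans h4

theorem lastRoot_lastRoot {ts : List PlanarTree} (h : ts ≠ []) (p p' s : ℕ) :
    lastRoot p s ts = lastRoot p' s ts := by
  cases ts with
  | nil => exact absurd rfl h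
  | cons t ts => rfl

/-- The cyclic sequence at the vertex `i`. -/
def vertexCycle {k : ℕ} (ts : List PlanarTree) (hts : leaves ts = k) (i : Fin k) :
    List HalfEdge :=
  (cycles (lastRoot 0 0 ts) 0 ts)[(i : ℕ)]'(by
    rw [length_cycles, hts]
    exact i.2)

theorem vertexCycle_mem {k : ℕ} (ts : List PlanarTree) (hts : leaves ts = k) (i : Fin k) :
    vertexCycle ts hts i ∈ cycles (lastRoot 0 0 ts) 0 ts :=
  List.getElem_mem _

theorem exists_vertexCycle {k : ℕ} (ts : List PlanarTree) (hts : leaves ts = k)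
    {l : List HalfEdge} (hl : l ∈ cycles (lastRoot 0 0 ts) 0 ts) :
    ∃ i, vertexCycle ts hts i = l := by
  obtain ⟨m, hm, rfl⟩ := List.getElem_of_mem hl
  exact ⟨⟨m, by rwa [length_cycles, hts] at hm⟩, rfl⟩

theorem vertexCycle_count {k : ℕ} (hk : 0 < k) (ts : List PlanarTree) (hts : leaves ts = k)
    (h : HalfEdge) : ∑ i, (vertexCycle ts hts i).count h =
      if h.1 ∈ Finset.range (2 * k) then 1 else 0 := by
  subst hts
  have hne : ts ≠ [] := by
    rintro rfl
    exact absurd hk (by simp [leaves])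
  have h1 := count_cycles ts (lastRoot 0 0 ts) 0 h.1 h.2
  rw [lastRoot_lastRoot hne (lastRoot 0 0 ts) 0 0] at h1
  have h2 : (cycles (lastRoot 0 0 ts) 0 ts).flatten.count h =
      if h.1 ∈ Finset.range (2 * leaves ts) then 1 else 0 := by
    simp only [Finset.mem_range, Prod.mk.eta] at h1 ⊢
    split_ifs at * <;> omega
  rw [← h2, List.count_flatten]
  have h3 := Fin.sum_univ_getElem ((cycles (lastRoot 0 0 ts) 0 ts).map (List.count h))
  rw [← h3]
  refine Fintype.sum_equiv (finCongr (by rw [List.length_map, length_cycles])) _ _ ?_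
  intro i
  simp [vertexCycle]

theorem vertexCycle_connected {k : ℕ} (hk : 0 < k) (ts : List PlanarTree)
    (hts : leaves ts = k) (T : Set (Fin k)) (hT : T.Nonempty)
    (hc : ∀ i j e b, (e, b) ∈ vertexCycle ts hts i → (e, !b) ∈ vertexCycle ts hts j →
      i ∈ T → j ∈ T) : T = Set.univ := by
  have hcount := vertexCycle_count hk ts hts
  set Q : ℕ → Prop := fun x => ∃ i ∈ T, (x, false) ∈ vertexCycle ts hts i with hQ
  have key : ∀ i, ∀ h ∈ vertexCycle ts hts i, (Q h.1 ↔ i ∈ T) := by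
    rintro i ⟨x, b⟩ hi
    obtain ⟨j, hj⟩ := exists_vertex_of_count hcount (h := (x, false))
      (show x ∈ Finset.range (2 * k) from mem_edges_of_count hcount hi)
    have h1 : Q x ↔ j ∈ T := by
      constructor
      · rintro ⟨m, hm, hm'⟩
        rwa [vertex_unique_of_count hcount hj hm']
      · exact fun h => ⟨j, h, hj⟩
    refine h1.trans ?_
    cases b
    · rw [vertex_unique_of_count hcount hi hj]
    · exact ⟨hc j i x false hj hi, hc i j x true hi hj⟩
  have hconn := connected_cycles Q ts (lastRoot 0 0 ts) 0 (by
    intro l hl h hh h' hh'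
    obtain ⟨i, rfl⟩ := exists_vertexCycle ts hts hl
    exact (key i h hh).trans (key i h' hh').symm)
  have hall : ∀ i, i ∈ T ↔ Q (loopEdge (lastRoot 0 0 ts)) := by
    intro i
    have h1 := vertexCycle_mem ts hts i
    have h2 := three_le_length_cycles ts _ _ _ h1
    obtain ⟨h, hh⟩ := List.exists_mem_of_length_pos (l := vertexCycle ts hts i) (by omega)
    exact (key i h hh).symm.trans (hconn _ h1 h hh)
  obtain ⟨i, hi⟩ := hT
  ext j
  simp only [Set.mem_univ, iff_true]
  exact (hall j).2 ((hall i).1 hi)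

/-- The ribbon graph with the trees `ts` along the large loop: one of the summands of an ornate
necklace, with its orientation.  It has as many vertices as leaves. -/
def graph {k : ℕ} (hk : 0 < k) (ts : List PlanarTree) (hts : leaves ts = k) :
    RibbonGraph k where
  edges := Finset.range (2 * k)
  cyc := vertexCycle ts hts
  count_eq := vertexCycle_count hk ts hts
  valence i := three_le_length_cycles ts _ _ _ (vertexCycle_mem ts hts i)
  pos := hk
  connected := vertexCycle_connected hk ts hts

/-- The numbers of the roots of the trees `ts`, the first one being `s`. -/
def roots : ℕ → List PlanarTree → List ℕ
  | _, [] => []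
  | s, t :: ts => s :: roots (s + t.numLeaves) ts

/-- The edges of the large loop. -/
def loopEdges (ts : List PlanarTree) : Finset ℕ := ((roots 0 ts).map loopEdge).toFinset

/-- The lowest edges of the trees `ts`. -/
def rootEdges (ts : List PlanarTree) : Finset ℕ :=
  (List.zipWith rootEdge ts (roots 0 ts)).toFinset

/-- The edges which emanate from the tops of the trees `ts`. -/
def topEdges (ts : List PlanarTree) : Finset ℕ := (Finset.range (leaves ts)).image leafEdge

/-- The remaining edges: the interior edges of the trees `ts`, which join two internal vertices
of a tree. -/
def interiorEdges (ts : List PlanarTree) : Finset ℕ :=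
  Finset.range (2 * leaves ts) \ (loopEdges ts ∪ rootEdges ts ∪ topEdges ts)

theorem finite_trees (i : ℕ) : {t : PlanarTree | t.numLeaves = i}.Finite := by
  refine (BinaryTree.treesOfNumNodesEq (i - 1)).finite_toSet.subset fun t ht => ?_
  rw [Finset.mem_coe, BinaryTree.mem_treesOfNumNodesEq]
  have := BinaryTree.numLeaves_eq_numNodes_succ t
  have ht' : t.numLeaves = i := ht
  omega

/-- A choice of a summand of `T_i` for each entry `i` of the sequence `c`. -/
abbrev TreeChoice (c : List ℕ) : Type := {ts : List PlanarTree // ts.map numLeaves = c}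

instance (c : List ℕ) : Finite (TreeChoice c) := by
  refine Set.Finite.to_subtype (s := {ts : List PlanarTree | ts.map numLeaves = c}) ?_
  induction c with
  | nil => simp
  | cons i c ih =>
    refine ((finite_trees i).image2 List.cons ih).subset ?_
    rintro (_ | ⟨t, ts⟩) h
    · simp at h
    · simp only [Set.mem_ofPred_eq, List.map_cons, List.cons.injEq] at h
      exact Set.mem_image2_of_mem h.1 h.2

noncomputable instance (c : List ℕ) : Fintype (TreeChoice c) := Fintype.ofFinite _

variable {k : ℕ}

/-- The summand of the ornate necklace `[i_1, …, i_n]` given by the trees `ts`. -/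
def summand (hk : 0 < k) (c : Composition k) (ts : TreeChoice c.blocks) : RibbonGraph k :=
  graph hk ts.1 (by rw [leaves, ts.2, c.blocks_sum])

/-- The ornate necklace `[i_1, …, i_n]`. -/
noncomputable def ornate (hk : 0 < k) (c : Composition k) : RG k :=
  ∑ ts : TreeChoice c.blocks, (summand hk c ts).toRG

/-- The number `|i_1, …, i_n|` of cyclic symmetries. -/
def symmetries (c : Composition k) : ℕ :=
  (Finset.univ.filter fun r : Fin c.length => c.blocks.rotate r = c.blocks).card

/-- Two sequences give isomorphic ornate necklaces if they differ by a cyclic permutation. -/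
def rotationSetoid (k : ℕ) : Setoid (Composition k) where
  r c c' := c.blocks ~r c'.blocks
  iseqv := ⟨fun _ => List.IsRotated.refl _, fun h => h.symm, fun h h' => h.trans h'⟩

/-- The isomorphism classes of ornate necklaces with `i_1 + ⋯ + i_n = k`. -/
abbrev NecklaceClass (k : ℕ) : Type := Quotient (rotationSetoid k)

noncomputable instance (k : ℕ) : Fintype (NecklaceClass k) := Fintype.ofFinite _

/-- The chain `Z_k`, the signed sum over the isomorphism classes of ornate necklaces. -/
noncomputable def Z (hk : 0 < k) : RG k :=
  ∑ q : NecklaceClass k,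
    ((-1 : ℚ) ^ q.out.length / (symmetries q.out : ℚ)) • ornate hk q.out

end Necklace

/-! The boundary is analysed one kind of edge at a time.

Interior edges cancel by associativity. Contracting one leaves a four-valent tree vertex, and such a
vertex can be resolved into two binary ones in exactly two ways, which a tree rotation exchanges.
Rotation does not disturb the left-to-right numbering of the internal vertices. The only difference
is that the contracted edge runs from the later to the earlier vertex in one graph and the other way
in the other, so the contractions are opposite (`contraction_of_rightRot`, `exists_involution`).

An edge from the top of a tree, at the leaf `u`, joins the parent of `u` to the root. The other
branch `R` at that parent sends its strands to the root right next to the strand of `u`. After the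
contraction the stem of `R` and its strands are consecutive at the merged vertex, and `R` meets the
rest of the graph nowhere else (`contract_topEdge_hasCutVertex`).

Two neighbouring roots fused along the large loop and a root fused with the first branching of its
tree give the same vertex, with the same numbering (`contraction_loopEdge_eq`). The numbers of trees
differ by one, hence so do the signs in `Z`.

For odd `k` a cyclic renumbering of the vertices is even, so rotating a necklace preserves the
orientation (`sgn_rotateIso`). By orbit counting, `Z` is then the sum over all sequences of `n`
trees with weight `(-1)^n / n` (`Z_eq_sum`). Rotations bring every contracted edge to the first
tree, which uses up the factor `1 / n` (`sum_sum_rotate`). Joining the first two trees matches the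
remaining loop terms with the remaining root terms (`sum_headContraction_loopEdge`); the unmatched
terms are contractions of loops, which are zero. -/

/-- The effect on half-edges of exchanging the labels `e` and `e'`. -/
def swapEdges (e e' : ℕ) (h : HalfEdge) : HalfEdge := (Equiv.swap e e' h.1, h.2)

/-! ### Comparing contractions of two different graphs. -/

namespace RibbonGraph

variable {n : ℕ}

/-- The label `e'` survives the contraction of `e`, and `e` survives the contraction of `e'`;
exchanging the two labels therefore matches the remaining edges. -/
theorem bijOn_swap_erase {s : Finset ℕ} {e e' : ℕ} (he : e ∈ s) (he' : e' ∈ s) :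
    Set.BijOn (Equiv.swap e e') (s.erase e : Finset ℕ) (s.erase e' : Finset ℕ) := by
  have hs : ∀ x, Equiv.swap e e' x ∈ s ↔ x ∈ s := by
    intro x
    rw [Equiv.swap_apply_def]
    split_ifs with h1 h2
    · subst h1; simp [he, he']
    · subst h2; simp [he, he']
    · rfl
  refine ⟨fun x hx => ?_, (Equiv.swap e e').injective.injOn, fun x hx => ?_⟩
  · simp only [Finset.coe_erase, Set.mem_sdiff, Finset.mem_coe, Set.mem_singleton_iff] at hx ⊢
    refine ⟨(hs x).2 hx.1, fun h => hx.2 ?_⟩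
    rwa [Equiv.swap_apply_eq_iff, Equiv.swap_apply_right] at h
  · simp only [Finset.coe_erase, Set.mem_sdiff, Finset.mem_coe, Set.mem_singleton_iff] at hx
    refine ⟨Equiv.swap e e' x, ?_, by simp⟩
    simp only [Finset.coe_erase, Set.mem_sdiff, Finset.mem_coe, Set.mem_singleton_iff]
    refine ⟨(hs x).2 hx.1, fun h => hx.2 ?_⟩
    rwa [Equiv.swap_apply_eq_iff, Equiv.swap_apply_left] at h

/-- Contractions of two graphs agree up to sign if the graphs correspond away from the contracted
edges and the merged vertices correspond. -/
theorem contraction_eq_sign_smul (X Y : RibbonGraph n) {e e' : ℕ} {a b : Fin n}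
    (σ : Equiv.Perm (Fin n)) (hab : a ≠ b)
    (ha : (e, false) ∈ X.cyc a) (hb : (e, true) ∈ X.cyc b)
    (ha' : (e', false) ∈ Y.cyc (σ a)) (hb' : (e', true) ∈ Y.cyc (σ b))
    (hedges : X.edges = Y.edges)
    (hσ : ∀ i, i ≠ a → i ≠ b → Y.cyc (σ i) = (X.cyc i).map (swapEdges e e'))
    (hm : after (e', false) (Y.cyc (σ a)) ++ after (e', true) (Y.cyc (σ b)) ~r
      (after (e, false) (X.cyc a) ++ after (e, true) (X.cyc b)).map (swapEdges e e')) :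
    X.contraction e = ((Equiv.Perm.sign σ : ℤ) : ℚ) • Y.contraction e' := by
  have hab' : σ a ≠ σ b := fun h => hab (σ.injective h)
  rw [contraction_eq X hab ha hb, contraction_eq Y hab' ha' hb']
  match n, X, Y, a, b, σ, hab, ha, hb, ha', hb', hedges, hσ, hm, hab' with
  | 0, _, _, a, _, _, _, _, _, _, _, _, _, _, _ => exact a.elim0
  | 1, _, _, a, b, _, hab, _, _, _, _, _, _, _, _ => exact absurd (Subsingleton.elim a b) hab
  | n + 2, X, Y, a, b, σ, hab, ha, hb, ha', hb', hedges, hσ, hm, hab' =>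
    simp only [contract, contractSign]
    set π := bringToFront a b with hπ
    set τ := bringToFront (σ a) (σ b) with hτ
    have π0 : π.symm 0 = a := by rw [Equiv.symm_apply_eq, hπ, bringToFront_left hab]
    have π1 : π.symm 1 = b := by rw [Equiv.symm_apply_eq, hπ, bringToFront_right]
    have τ0 : τ.symm 0 = σ a := by rw [Equiv.symm_apply_eq, hτ, bringToFront_left hab']
    have τ1 : τ.symm 1 = σ b := by rw [Equiv.symm_apply_eq, hτ, bringToFront_right]
    -- In the numberings with the contracted edge in front, `σ` becomes a permutation fixing both
    -- merged vertices. It descends to the contracted graphs without change of sign.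
    obtain ⟨ρ, r0, rs, rsgn⟩ := exists_merged_perm (τ * σ * π⁻¹)
      (by simp only [Equiv.Perm.mul_apply, Equiv.Perm.inv_def, π0]
          rw [← τ0, Equiv.apply_symm_apply])
      (by simp only [Equiv.Perm.mul_apply, Equiv.Perm.inv_def, π1]
          rw [← τ1, Equiv.apply_symm_apply])
    have hfun : (fun h : HalfEdge => (Equiv.swap e e' h.1, xor h.2 ((fun _ => false) h.1))) =
        swapEdges e e' := by
      funext h
      simp [swapEdges]
    let ψ : Iso ((X.relabel π).contractFirst e (mem_relabel_left X hab ha)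
          (mem_relabel_right X hb))
        ((Y.relabel τ).contractFirst e' (mem_relabel_left Y hab' ha')
          (mem_relabel_right Y hb')) :=
      { edge := Equiv.swap e e'
        flip := fun _ => false
        vertex := ρ
        bijOn := by
          have := bijOn_swap_erase (X.mem_edges ha) (by
            rw [hedges]; exact Y.mem_edges ha')
          simp only [contractFirst, relabel]
          rwa [← hedges]
        cyc := by
          rw [hfun]
          refine Fin.cases ?_ (fun j => ?_)
          · rw [r0]
            simp only [contractFirst, Fin.cons_zero, relabel, π0, π1, τ0, τ1]
            exact hm
          · obtain ⟨m, hm'⟩ : ∃ m, ρ j.succ = Fin.succ m := by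
              refine (Fin.exists_succ_eq.2 fun h => ?_).imp fun _ h => h.symm
              rw [← r0] at h
              exact Fin.succ_ne_zero _ (ρ.injective h)
            have h1 := rs j
            rw [hm'] at h1 ⊢
            simp only [contractFirst, Fin.cons_succ, relabel]
            rw [← h1]
            simp only [Equiv.Perm.mul_apply, Equiv.symm_apply_apply, Equiv.Perm.inv_def]
            rw [hσ]
            · intro h
              rw [← π0, π.symm.injective.eq_iff] at h
              exact Fin.succ_ne_zero _ h
            · intro h
              rw [← π1, π.symm.injective.eq_iff] at h
              exact Fin.succ_ne_zero j (Fin.succ_injective _ h) }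
    rw [toRG_eq ψ, smul_smul, smul_smul]
    congr 1
    have h1 := perm_sign_mul_self π
    have h2 : ψ.sgn = ((Equiv.Perm.sign ρ : ℤ) : ℚ) := by simp [Iso.sgn, ψ]
    rw [h2, rsgn, Equiv.Perm.sign_mul, Equiv.Perm.sign_mul, Equiv.Perm.sign_inv]
    push_cast
    linear_combination (((Equiv.Perm.sign τ : ℤ) : ℚ) * ((Equiv.Perm.sign σ : ℤ) : ℚ)) * h1

section Lists

variable {X Y : RibbonGraph n} {A B C : List (List HalfEdge)} {x y x' y' : List HalfEdge}
  {e e' : ℕ}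

theorem cyc_eq_getElem {L : List (List HalfEdge)} (h : List.ofFn X.cyc = L) (i : Fin n) :
    X.cyc i = L[(i : ℕ)]'(by rw [← h]; simp) := by
  subst h
  simp

/-- The positions of two distinguished members of a list, and the correspondence elsewhere. -/
theorem exists_positions {f : List HalfEdge → List HalfEdge}
    (hX : List.ofFn X.cyc = A ++ x :: B ++ y :: C)
    (hY : List.ofFn Y.cyc = A.map f ++ x' :: B.map f ++ y' :: C.map f) :
    ∃ a b : Fin n, a ≠ b ∧ X.cyc a = x ∧ X.cyc b = y ∧ Y.cyc a = x' ∧ Y.cyc b = y' ∧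
      ∀ i, i ≠ a → i ≠ b → Y.cyc i = f (X.cyc i) := by
  have hlen := congrArg List.length hX
  simp only [List.length_ofFn, List.length_append, List.length_cons] at hlen
  refine ⟨⟨A.length, by omega⟩, ⟨A.length + 1 + B.length, by omega⟩, ?_, ?_, ?_, ?_, ?_, ?_⟩
  · simp only [ne_eq, Fin.mk.injEq]
    omega
  · rw [cyc_eq_getElem hX]
    simp
  · rw [cyc_eq_getElem hX]
    simp only [List.getElem_append, List.getElem_cons, List.length_append, List.length_cons]
    split_ifs <;> first | omega | rfl
  · rw [cyc_eq_getElem hY]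
    simp
  · rw [cyc_eq_getElem hY]
    simp only [List.getElem_append, List.getElem_cons, List.length_append, List.length_cons,
      List.length_map]
    split_ifs <;> first | omega | rfl
  · rintro ⟨i, hi⟩ h1 h2
    simp only [ne_eq, Fin.mk.injEq] at h1 h2
    rw [cyc_eq_getElem hX, cyc_eq_getElem hY]
    simp only [List.getElem_append, List.getElem_cons, List.length_append, List.length_cons,
      List.length_map]
    split_ifs <;> first | omega | simp

/-- Here both contracted edges run from the earlier to the later distinguished position, so the
vertices correspond by the identity and no sign arises. -/
theorem contraction_eq_of_lists (hedges : X.edges = Y.edges)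
    (hX : List.ofFn X.cyc = A ++ x :: B ++ y :: C)
    (hY : List.ofFn Y.cyc = A.map (List.map (swapEdges e e')) ++ x' ::
      B.map (List.map (swapEdges e e')) ++ y' :: C.map (List.map (swapEdges e e')))
    (hx : (e, false) ∈ x) (hy : (e, true) ∈ y) (hx' : (e', false) ∈ x') (hy' : (e', true) ∈ y')
    (hm : after (e', false) x' ++ after (e', true) y' ~r
      (after (e, false) x ++ after (e, true) y).map (swapEdges e e')) :
    X.contraction e = Y.contraction e' := by
  obtain ⟨a, b, hab, rfl, rfl, rfl, rfl, hi⟩ := exists_positions hX hY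
  simpa using contraction_eq_sign_smul X Y 1 hab hx hy hx' hy' hedges hi hm

/-- The edge `e` runs from the later position to the earlier one, while `e'` runs forwards. Matching
start with start forces a transposition of the two positions, which is the source of the minus sign.
-/
theorem contraction_eq_neg_of_lists (hedges : X.edges = Y.edges)
    (hX : List.ofFn X.cyc = A ++ x :: B ++ y :: C)
    (hY : List.ofFn Y.cyc = A.map (List.map (swapEdges e e')) ++ x' ::
      B.map (List.map (swapEdges e e')) ++ y' :: C.map (List.map (swapEdges e e')))
    (hx : (e, true) ∈ x) (hy : (e, false) ∈ y) (hx' : (e', false) ∈ x') (hy' : (e', true) ∈ y')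
    (hm : after (e', false) x' ++ after (e', true) y' ~r
      (after (e, false) y ++ after (e, true) x).map (swapEdges e e')) :
    X.contraction e = -Y.contraction e' := by
  obtain ⟨a, b, hab, rfl, rfl, rfl, rfl, hi⟩ := exists_positions hX hY
  have h := contraction_eq_sign_smul X Y (a := b) (b := a) (Equiv.swap a b) hab.symm hy hx
    (by simpa using hx') (by simpa using hy') hedges
    (fun i h1 h2 => by rw [Equiv.swap_apply_of_ne_of_ne h2 h1]; exact hi i h2 h1)
    (by simpa using hm)
  rw [h, Equiv.Perm.sign_swap hab]
  simp

end Lists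

end RibbonGraph

/-! ### Interior tree edges: cancellation by tree rotation. -/

namespace Necklace

open BinaryTree

/-- A tree owns a block of labels, and `count_nodeCycles` shows that its internal vertices use only
that block. The lower bound is strict because `2 * s` is the loop edge. Hence relabelling outside
the block leaves the tree unchanged. -/
theorem mem_nodeCycles_bounds {t : PlanarTree} {s : ℕ} {l : List HalfEdge} {h : HalfEdge}
    (hl : l ∈ nodeCycles t s) (hh : h ∈ l) : 2 * s < h.1 ∧ h.1 < 2 * (s + t.numLeaves) := by
  obtain ⟨x, b⟩ := h
  have h1 := count_nodeCycles t s x b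
  have h2 : 0 < (nodeCycles t s).flatten.count (x, b) :=
    List.count_pos_iff.2 (List.mem_flatten.2 ⟨l, hl, hh⟩)
  dsimp only
  split_ifs at h1 <;> omega

theorem rootEdge_bounds (t : PlanarTree) (s : ℕ) :
    2 * s < rootEdge t s ∧ rootEdge t s < 2 * (s + t.numLeaves) := by
  cases t with
  | nil => simp [rootEdge, leafEdge]; omega
  | node _ l r =>
    have h1 := numLeaves_pos' l
    have h2 := numLeaves_pos' r
    simp only [rootEdge, nodeEdge, numLeaves]
    omega

theorem map_swapEdges {e e' : ℕ} {l : List HalfEdge} (h : ∀ x ∈ l, x.1 ≠ e ∧ x.1 ≠ e') :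
    l.map (swapEdges e e') = l := by
  conv_rhs => rw [← List.map_id l]
  refine List.map_congr_left fun x hx => ?_
  rw [swapEdges, Equiv.swap_apply_of_ne_of_ne (h x hx).1 (h x hx).2]
  rfl

theorem map_map_swapEdges {e e' : ℕ} {L : List (List HalfEdge)}
    (h : ∀ l ∈ L, ∀ x ∈ l, x.1 ≠ e ∧ x.1 ≠ e') :
    L.map (List.map (swapEdges e e')) = L := by
  conv_rhs => rw [← List.map_id L]
  exact List.map_congr_left fun l hl => map_swapEdges (h l hl)

theorem map_nodeCycles {e e' : ℕ} {t : PlanarTree} {s : ℕ}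
    (he : e ≤ 2 * s ∨ 2 * (s + t.numLeaves) ≤ e)
    (he' : e' ≤ 2 * s ∨ 2 * (s + t.numLeaves) ≤ e') :
    (nodeCycles t s).map (List.map (swapEdges e e')) = nodeCycles t s := by
  refine map_map_swapEdges fun l hl x hx => ?_
  have := mem_nodeCycles_bounds hl hx
  omega

theorem ofFn_cyc_graph {k : ℕ} (hk : 0 < k) (ts : List PlanarTree) (hts : leaves ts = k) :
    List.ofFn (graph hk ts hts).cyc = cycles (lastRoot 0 0 ts) 0 ts := by
  refine List.ext_getElem (by rw [List.length_ofFn, length_cycles, hts]) fun i h1 h2 => ?_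
  rw [List.getElem_ofFn]
  rfl

theorem leaves_cons (t : PlanarTree) (ts : List PlanarTree) :
    leaves (t :: ts) = t.numLeaves + leaves ts := by
  simp [leaves]

/-- `Rot t s m p t'`: rotating the tree `t` (with root number `s`) at the interior edge between
the internal vertex `m` and its parent `p` gives `t'`, in which `m` is the parent of `p`. -/
inductive Rot : PlanarTree → ℕ → ℕ → ℕ → PlanarTree → Prop
  | right {A B C : PlanarTree} {s m p : ℕ} (hm : m = s + A.numLeaves)
      (hp : p = s + A.numLeaves + B.numLeaves) :
      Rot (node () (node () A B) C) s m p (node () A (node () B C))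
  | left {A B C : PlanarTree} {s m p : ℕ} (hm : m = s + A.numLeaves + B.numLeaves)
      (hp : p = s + A.numLeaves) :
      Rot (node () A (node () B C)) s m p (node () (node () A B) C)
  | inl {l l' r : PlanarTree} {s m p : ℕ} (h : Rot l s m p l') :
      Rot (node () l r) s m p (node () l' r)
  | inr {l r r₁ : PlanarTree} {s m p : ℕ} (h : Rot r (s + l.numLeaves) m p r₁) :
      Rot (node () l r) s m p (node () l r₁)

/-- The rotations of `Rot` which turn a left child into the parent. -/
inductive RightRot : PlanarTree → ℕ → ℕ → ℕ → PlanarTree → Prop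
  | base {A B C : PlanarTree} {s m p : ℕ} (hm : m = s + A.numLeaves)
      (hp : p = s + A.numLeaves + B.numLeaves) :
      RightRot (node () (node () A B) C) s m p (node () A (node () B C))
  | inl {l l' r : PlanarTree} {s m p : ℕ} (h : RightRot l s m p l') :
      RightRot (node () l r) s m p (node () l' r)
  | inr {l r r₁ : PlanarTree} {s m p : ℕ} (h : RightRot r (s + l.numLeaves) m p r₁) :
      RightRot (node () l r) s m p (node () l r₁)

theorem Rot.bounds {t t' : PlanarTree} {s m p : ℕ} (h : Rot t s m p t') :
    s < m ∧ m < s + t.numLeaves ∧ s < p ∧ p < s + t.numLeaves ∧ m ≠ p ∧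
      rootEdge t s ≠ 2 * m ∧ t'.numLeaves = t.numLeaves := by
  induction h with
  | @right A B C s m p hm hp =>
    have h1 := numLeaves_pos' A
    have h2 := numLeaves_pos' B
    have h3 := numLeaves_pos' C
    simp only [rootEdge, nodeEdge, numLeaves]
    omega
  | @left A B C s m p hm hp =>
    have h1 := numLeaves_pos' A
    have h2 := numLeaves_pos' B
    have h3 := numLeaves_pos' C
    simp only [rootEdge, nodeEdge, numLeaves]
    omega
  | @inl l l' r s m p h ih =>
    simp only [rootEdge, nodeEdge, numLeaves]
    omega
  | @inr l r r' s m p h ih =>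
    simp only [rootEdge, nodeEdge, numLeaves]
    omega

theorem Rot.symm {t t' : PlanarTree} {s m p : ℕ} (h : Rot t s m p t') : Rot t' s p m t := by
  induction h with
  | right hm hp => exact .left hp hm
  | left hm hp => exact .right hp hm
  | inl h ih => exact .inl ih
  | inr h ih => exact .inr ih

/-- Left rotations are inverse to right ones, so the sign has to be computed for right rotations
only. -/
theorem Rot.rightRot {t t' : PlanarTree} {s m p : ℕ} (h : Rot t s m p t') :
    RightRot t s m p t' ∨ RightRot t' s p m t := by
  induction h with
  | right hm hp => exact .inl (.base hm hp)
  | left hm hp => exact .inr (.base hp hm)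
  | inl h ih => exact ih.imp .inl .inl
  | inr h ih => exact ih.imp .inr .inr

theorem RightRot.rot {t t' : PlanarTree} {s m p : ℕ} (h : RightRot t s m p t') :
    Rot t s m p t' := by
  induction h with
  | base hm hp => exact .right hm hp
  | inl h ih => exact .inl ih
  | inr h ih => exact .inr ih

/-- The vertex `m` determines the edge entering it and hence the rotation. In the mixed cases the
numerical bounds place `m` in two disjoint parts of the tree, or make it the top vertex of a branch
where that is excluded. -/
theorem Rot.unique {t t₁ t₂ : PlanarTree} {s m p₁ p₂ : ℕ} (h₁ : Rot t s m p₁ t₁)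
    (h₂ : Rot t s m p₂ t₂) : p₁ = p₂ ∧ t₁ = t₂ := by
  induction h₁ generalizing p₂ t₂ with
  | @right _ B _ _ _ _ hm hp =>
    have := numLeaves_pos' B
    cases h₂ with
    | right hm' hp' => exact ⟨hp.trans hp'.symm, rfl⟩
    | left hm' hp' => simp only [numLeaves] at hm'; omega
    | inl h => have := h.bounds; simp only [rootEdge, nodeEdge] at this; omega
    | inr h => have := h.bounds; simp only [numLeaves] at this; omega
  | left hm hp =>
    cases h₂ with
    | @right _ B' _ _ _ _ hm' hp' =>
      have := numLeaves_pos' B'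
      simp only [numLeaves] at hm
      omega
    | left hm' hp' => exact ⟨hp.trans hp'.symm, rfl⟩
    | inl h => have := h.bounds; omega
    | inr h => have := h.bounds; simp only [rootEdge, nodeEdge] at this; omega
  | inl h ih =>
    have hb := h.bounds
    cases h₂ with
    | right hm' hp' => simp only [rootEdge, nodeEdge] at hb; omega
    | left hm' hp' => omega
    | inl h' =>
      obtain ⟨rfl, rfl⟩ := ih h'
      exact ⟨rfl, rfl⟩
    | inr h' => have := h'.bounds; omega
  | inr h ih =>
    have hb := h.bounds
    cases h₂ with
    | right hm' hp' => simp only [numLeaves] at hb; omega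
    | left hm' hp' => simp only [rootEdge, nodeEdge] at hb; omega
    | inl h' => have := h'.bounds; omega
    | inr h' =>
      obtain ⟨rfl, rfl⟩ := ih h'
      exact ⟨rfl, rfl⟩

/-- An internal vertex other than the lowest one has an internal parent, and one can rotate at the
edge between them. The vertex sits directly above the current node when its number is read off the
root edge of a branch; otherwise descend. -/
theorem exists_rot {t : PlanarTree} {s m : ℕ} (h1 : s < m) (h2 : m < s + t.numLeaves)
    (h3 : rootEdge t s ≠ 2 * m) : ∃ p t', Rot t s m p t' := by
  induction t generalizing s with
  | nil => simp only [numLeaves] at h2; omega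
  | node _ l r hl hr =>
    simp only [rootEdge, nodeEdge, numLeaves] at h2 h3
    rcases lt_or_gt_of_ne (show m ≠ s + l.numLeaves by omega) with h | h
    · by_cases h4 : rootEdge l s = 2 * m
      · cases l with
        | nil => simp only [rootEdge, leafEdge] at h4; omega
        | node _ A B =>
          simp only [rootEdge, nodeEdge] at h4
          exact ⟨_, _, .right (by omega) rfl⟩
      · obtain ⟨p, t', ht⟩ := hl h1 h h4
        exact ⟨p, _, .inl ht⟩
    · by_cases h4 : rootEdge r (s + l.numLeaves) = 2 * m
      · cases r with
        | nil => simp only [rootEdge, leafEdge] at h4; omega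
        | node _ B C =>
          simp only [rootEdge, nodeEdge] at h4
          exact ⟨_, _, .left (by omega) rfl⟩
      · obtain ⟨p, t', ht⟩ := hr h (by omega) h4
        exact ⟨p, _, .inr ht⟩

/-- Left-to-right order is insensitive to rotation, so `m` and `p` keep their positions. The edge
from below enters `p` before and `m` after the rotation; elsewhere the change is therefore just the
exchange of the labels `2 * m` and `2 * p`. The numbers `a`, `b`, `c` are the stems of the three
branches. -/
theorem RightRot.exists_nodeCycles {t t' : PlanarTree} {s m p : ℕ} (h : RightRot t s m p t') :
    rootEdge t' s = Equiv.swap (2 * m) (2 * p) (rootEdge t s) ∧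
    ∃ (A B C : List (List HalfEdge)) (a b c : ℕ),
      nodeCycles t s = A ++ [(2 * m, true), (b, false), (a, false)] :: B ++
        [(2 * p, true), (c, false), (2 * m, false)] :: C ∧
      nodeCycles t' s = A.map (List.map (swapEdges (2 * m) (2 * p))) ++
        [(2 * m, true), (2 * p, false), (a, false)] ::
          B.map (List.map (swapEdges (2 * m) (2 * p))) ++
        [(2 * p, true), (c, false), (b, false)] ::
          C.map (List.map (swapEdges (2 * m) (2 * p))) ∧
      ∀ x ∈ [a, b, c], x ≠ 2 * m ∧ x ≠ 2 * p := by
  induction h with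
  | @base A B C s m p hm hp =>
    have h1 := numLeaves_pos' A
    have h2 := numLeaves_pos' B
    have h3 := rootEdge_bounds A s
    have h4 := rootEdge_bounds B m
    have h5 := rootEdge_bounds C p
    have e1 : s + A.numLeaves = m := hm.symm
    have e2 : m + B.numLeaves = p := by omega
    have e3 : s + (A.numLeaves + B.numLeaves) = p := by omega
    refine ⟨by simp [rootEdge, nodeEdge, numLeaves, e1, e3],
      nodeCycles A s, nodeCycles B m, nodeCycles C p, rootEdge A s, rootEdge B m,
      rootEdge C p, ?_, ?_, ?_⟩
    · simp [nodeCycles, rootEdge, nodeEdge, numLeaves, e1, e3]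
    · rw [map_nodeCycles, map_nodeCycles, map_nodeCycles]
      · simp [nodeCycles, rootEdge, nodeEdge, e1, e2]
      all_goals omega
    · simp only [List.mem_cons, List.not_mem_nil, or_false]
      rintro x (rfl | rfl | rfl) <;> omega
  | @inl l l' r s m p h ih =>
    obtain ⟨hr, A, B, C, a, b, c, h1, h2, h3⟩ := ih
    have hb := h.rot.bounds
    have hb' := rootEdge_bounds r (s + l.numLeaves)
    have hm : nodeCycles r (s + l.numLeaves) = _ :=
      (map_nodeCycles (e := 2 * m) (e' := 2 * p) (by omega) (by omega)).symm
    refine ⟨?_, A, B, C ++ [(nodeEdge (s + l.numLeaves), true),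
      (rootEdge r (s + l.numLeaves), false), (rootEdge l s, false)] ::
      nodeCycles r (s + l.numLeaves), a, b, c, ?_, ?_, h3⟩
    · simp only [rootEdge, nodeEdge, hb.2.2.2.2.2.2]
      rw [Equiv.swap_apply_of_ne_of_ne] <;> omega
    · simp [nodeCycles, h1]
    · rw [nodeCycles, h2, hr, hb.2.2.2.2.2.2, List.map_append, List.map_cons, ← hm]
      simp only [List.map_cons, List.map_nil, swapEdges, nodeEdge]
      rw [Equiv.swap_apply_of_ne_of_ne (x := 2 * (s + l.numLeaves)) (by omega) (by omega),
        Equiv.swap_apply_of_ne_of_ne (x := rootEdge r (s + l.numLeaves)) (by omega) (by omega)]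
      simp
  | @inr l r r' s m p h ih =>
    obtain ⟨hr, A, B, C, a, b, c, h1, h2, h3⟩ := ih
    have hb := h.rot.bounds
    have hb' := rootEdge_bounds l s
    have hm : nodeCycles l s = _ :=
      (map_nodeCycles (e := 2 * m) (e' := 2 * p) (by omega) (by omega)).symm
    refine ⟨?_, nodeCycles l s ++ [(nodeEdge (s + l.numLeaves), true),
      (rootEdge r (s + l.numLeaves), false), (rootEdge l s, false)] :: A, B, C, a, b, c,
      ?_, ?_, h3⟩
    · simp only [rootEdge, nodeEdge]
      rw [Equiv.swap_apply_of_ne_of_ne] <;> omega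
    · simp [nodeCycles, h1]
    · rw [nodeCycles, h2, hr, List.map_append, List.map_cons, ← hm]
      simp only [List.map_cons, List.map_nil, swapEdges, nodeEdge]
      rw [Equiv.swap_apply_of_ne_of_ne (x := 2 * (s + l.numLeaves)) (by omega) (by omega),
        Equiv.swap_apply_of_ne_of_ne (x := rootEdge l s) (by omega) (by omega)]
      simp

theorem roots_bounds {ts : List PlanarTree} {s x : ℕ} (h : x ∈ roots s ts) :
    s ≤ x ∧ x < s + leaves ts := by
  induction ts generalizing s with
  | nil => simp [roots] at h
  | cons t ts ih =>
    have := numLeaves_pos' t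
    rw [leaves_cons]
    rcases List.mem_cons.1 h with rfl | h
    · omega
    · have := ih h
      omega

theorem rootEdgeList_bounds {ts : List PlanarTree} {s x : ℕ}
    (h : x ∈ List.zipWith rootEdge ts (roots s ts)) :
    2 * s < x ∧ x < 2 * (s + leaves ts) := by
  induction ts generalizing s with
  | nil => simp [roots] at h
  | cons t ts ih =>
    have := numLeaves_pos' t
    have h1 := rootEdge_bounds t s
    rw [leaves_cons]
    rcases List.mem_cons.1 h with rfl | h
    · omega
    · have := ih h
      omega

theorem lastRoot_mem (p s : ℕ) (ts : List PlanarTree) : lastRoot p s ts ∈ p :: roots s ts := by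
  induction ts generalizing p s with
  | nil => simp [lastRoot]
  | cons t ts ih => exact List.mem_cons_of_mem _ (ih s (s + t.numLeaves))

theorem lastRoot_congr {ts ts' : List PlanarTree} (h : ts'.map numLeaves = ts.map numLeaves)
    (p s : ℕ) : lastRoot p s ts' = lastRoot p s ts := by
  induction ts generalizing p s ts' with
  | nil =>
    rw [List.map_nil, List.map_eq_nil_iff] at h
    rw [h]
  | cons t ts ih =>
    obtain ⟨t', ts', rfl⟩ : ∃ t' u, ts' = t' :: u := by
      cases ts' with
      | nil => simp at h
      | cons t' u => exact ⟨t', u, rfl⟩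
    simp only [List.map_cons, List.cons.injEq] at h
    rw [lastRoot, lastRoot, ih h.2, h.1]

/-- The preceding root `P` needs its own hypothesis, as its loop edge enters the first tree from
outside the block of labels. -/
theorem map_cycles {e e' : ℕ} {ts : List PlanarTree} {P s : ℕ}
    (hP : 2 * P ≠ e ∧ 2 * P ≠ e')
    (he : e < 2 * s ∨ 2 * (s + leaves ts) ≤ e) (he' : e' < 2 * s ∨ 2 * (s + leaves ts) ≤ e') :
    (cycles P s ts).map (List.map (swapEdges e e')) = cycles P s ts := by
  induction ts generalizing P s with
  | nil => rfl
  | cons t ts ih =>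
    have := numLeaves_pos' t
    have hr := rootEdge_bounds t s
    rw [leaves_cons] at he he'
    rw [cycles, List.map_append, List.map_cons, ih (by omega) (by omega) (by omega),
      map_nodeCycles (by omega) (by omega), map_swapEdges]
    intro x hx
    simp only [rootCycle, loopEdge, leafEdge, List.mem_cons, List.mem_map,
      List.mem_range'_1] at hx
    rcases hx with rfl | rfl | rfl | ⟨u, hu, rfl⟩ <;> dsimp only <;> omega

/-- The relation `R` between trees, for one entry of a sequence of trees. -/
inductive OnEntry (R : PlanarTree → ℕ → ℕ → ℕ → PlanarTree → Prop) :
    List PlanarTree → ℕ → ℕ → ℕ → List PlanarTree → Prop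
  | head {t t' : PlanarTree} {ts : List PlanarTree} {s m p : ℕ} (h : R t s m p t') :
      OnEntry R (t :: ts) s m p (t' :: ts)
  | tail {t : PlanarTree} {ts ts' : List PlanarTree} {s m p : ℕ}
      (h : OnEntry R ts (s + t.numLeaves) m p ts') : OnEntry R (t :: ts) s m p (t :: ts')

theorem OnEntry.symm {ts ts' : List PlanarTree} {s m p : ℕ} (h : OnEntry Rot ts s m p ts') :
    OnEntry Rot ts' s p m ts := by
  induction h with
  | head h => exact .head h.symm
  | tail h ih => exact .tail ih

theorem OnEntry.rightRot {ts ts' : List PlanarTree} {s m p : ℕ}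
    (h : OnEntry Rot ts s m p ts') :
    OnEntry RightRot ts s m p ts' ∨ OnEntry RightRot ts' s p m ts := by
  induction h with
  | head h => exact h.rightRot.imp .head .head
  | tail h ih => exact ih.imp .tail .tail

theorem OnEntry.rot {ts ts' : List PlanarTree} {s m p : ℕ} (h : OnEntry RightRot ts s m p ts') :
    OnEntry Rot ts s m p ts' := by
  induction h with
  | head h => exact .head h.rot
  | tail h ih => exact .tail ih

theorem OnEntry.bounds {ts ts' : List PlanarTree} {s m p : ℕ} (h : OnEntry Rot ts s m p ts') :
    s < m ∧ m < s + leaves ts ∧ s < p ∧ p < s + leaves ts ∧ m ≠ p ∧ m ∉ roots s ts ∧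
      2 * m ∉ List.zipWith rootEdge ts (roots s ts) ∧
      ts'.map numLeaves = ts.map numLeaves := by
  induction h with
  | @head t t' ts s m p h =>
    have hb := h.bounds
    rw [leaves_cons]
    refine ⟨by omega, by omega, by omega, by omega, by omega, fun hm => ?_, fun hm => ?_,
      by simp [hb]⟩
    · rcases List.mem_cons.1 hm with hm | hm
      · omega
      · have := roots_bounds hm
        omega
    · rcases List.mem_cons.1 hm with hm | hm
      · omega
      · have := rootEdgeList_bounds hm
        omega
  | @tail t ts ts' s m p h ih =>
    have ht := numLeaves_pos' t
    have hr := rootEdge_bounds t s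
    obtain ⟨h1, h2, h3, h4, h5, h6, h7, h8⟩ := ih
    rw [leaves_cons]
    refine ⟨by omega, by omega, by omega, by omega, by omega, fun hm => ?_, fun hm => ?_,
      by simp [h8]⟩
    · rcases List.mem_cons.1 hm with hm | hm
      · omega
      · exact h6 hm
    · rcases List.mem_cons.1 hm with hm | hm
      · omega
      · exact h7 hm

theorem OnEntry.unique {ts ts₁ ts₂ : List PlanarTree} {s m p₁ p₂ : ℕ}
    (h₁ : OnEntry Rot ts s m p₁ ts₁) (h₂ : OnEntry Rot ts s m p₂ ts₂) :
    p₁ = p₂ ∧ ts₁ = ts₂ := by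
  induction h₁ generalizing p₂ ts₂ with
  | head h =>
    cases h₂ with
    | head h' =>
      obtain ⟨rfl, rfl⟩ := h.unique h'
      exact ⟨rfl, rfl⟩
    | tail h' => have := h.bounds; have := h'.bounds; omega
  | tail h ih =>
    cases h₂ with
    | head h' => have := h.bounds; have := h'.bounds; omega
    | tail h' =>
      obtain ⟨rfl, rfl⟩ := ih h'
      exact ⟨rfl, rfl⟩

theorem exists_onEntry_rot {ts : List PlanarTree} {s m : ℕ} (h1 : s ≤ m)
    (h2 : m < s + leaves ts) (h3 : m ∉ roots s ts)
    (h4 : 2 * m ∉ List.zipWith rootEdge ts (roots s ts)) :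
    ∃ p ts', OnEntry Rot ts s m p ts' := by
  induction ts generalizing s with
  | nil => simp [leaves] at h2; omega
  | cons t ts ih =>
    rw [leaves_cons] at h2
    simp only [roots, List.mem_cons, not_or, List.zipWith_cons_cons] at h3 h4
    by_cases h : m < s + t.numLeaves
    · obtain ⟨p, t', ht⟩ := exists_rot (by omega) h (Ne.symm h4.1)
      exact ⟨p, _, .head ht⟩
    · obtain ⟨p, ts', ht⟩ := ih (s := s + t.numLeaves) (by omega) (by omega) h3.2 h4.2
      exact ⟨p, _, .tail ht⟩

/-- Interior edges were defined as what is left over. Odd labels are top edges, and an even label `2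
* m` that is neither a loop edge nor a root edge enters a vertex at which a rotation is possible. -/
theorem mem_interiorEdges_iff {ts : List PlanarTree} {e : ℕ} :
    e ∈ interiorEdges ts ↔ ∃ m p ts', e = 2 * m ∧ OnEntry Rot ts 0 m p ts' := by
  simp only [interiorEdges, loopEdges, rootEdges, topEdges, Finset.mem_sdiff, Finset.mem_range,
    Finset.mem_union, List.mem_toFinset, Finset.mem_image, not_or, List.mem_map, leafEdge,
    loopEdge]
  constructor
  · rintro ⟨h1, ⟨h2, h3⟩, h4⟩
    obtain ⟨m, rfl⟩ : ∃ m, e = 2 * m := by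
      rcases Nat.even_or_odd' e with ⟨m, rfl | rfl⟩
      · exact ⟨m, rfl⟩
      · exact absurd ⟨m, by omega, rfl⟩ h4
    obtain ⟨p, ts', h⟩ := exists_onEntry_rot (Nat.zero_le m) (by omega)
      (fun h => h2 ⟨m, h, rfl⟩) h3
    exact ⟨m, p, ts', rfl, h⟩
  · rintro ⟨m, p, ts', rfl, h⟩
    have hb := h.bounds
    refine ⟨by omega, ⟨?_, hb.2.2.2.2.2.2.1⟩, ?_⟩
    · rintro ⟨x, hx, hxm⟩
      exact hb.2.2.2.2.2.1 (by rwa [show m = x by omega])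
    · rintro ⟨x, hx, hxm⟩
      omega

theorem OnEntry.exists_cycles {ts ts' : List PlanarTree} {s m p : ℕ}
    (h : OnEntry RightRot ts s m p ts') {P : ℕ} (hPm : P ≠ m) (hPp : P ≠ p) :
    ∃ (A B C : List (List HalfEdge)) (a b c : ℕ),
      cycles P s ts = A ++ [(2 * m, true), (b, false), (a, false)] :: B ++
        [(2 * p, true), (c, false), (2 * m, false)] :: C ∧
      cycles P s ts' = A.map (List.map (swapEdges (2 * m) (2 * p))) ++
        [(2 * m, true), (2 * p, false), (a, false)] ::
          B.map (List.map (swapEdges (2 * m) (2 * p))) ++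
        [(2 * p, true), (c, false), (b, false)] ::
          C.map (List.map (swapEdges (2 * m) (2 * p))) ∧
      ∀ x ∈ [a, b, c], x ≠ 2 * m ∧ x ≠ 2 * p := by
  induction h generalizing P with
  | @head t t' ts s m p h =>
    obtain ⟨hr, A, B, C, a, b, c, h1, h2, h3⟩ := h.exists_nodeCycles
    have hb := h.rot.bounds
    have hm : cycles s (s + t.numLeaves) ts = _ :=
      (map_cycles (e := 2 * m) (e' := 2 * p) (by omega) (by omega) (by omega)).symm
    have hroot : rootCycle P s t' = (rootCycle P s t).map (swapEdges (2 * m) (2 * p)) := by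
      simp only [rootCycle, List.map_cons, loopEdge, hr, hb.2.2.2.2.2.2]
      rw [map_swapEdges (l := List.map _ _)]
      · simp only [swapEdges]
        rw [Equiv.swap_apply_of_ne_of_ne (x := 2 * s) (by omega) (by omega),
          Equiv.swap_apply_of_ne_of_ne (x := 2 * P) (by omega) (by omega)]
      · intro x hx
        simp only [leafEdge, List.mem_map] at hx
        obtain ⟨u, hu, rfl⟩ := hx
        dsimp only
        omega
    refine ⟨rootCycle P s t :: A, B, C ++ cycles s (s + t.numLeaves) ts, a, b, c, ?_, ?_, h3⟩
    · simp [cycles, h1]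
    · rw [cycles, h2, hroot, hb.2.2.2.2.2.2, List.map_append, ← hm]
      simp
  | @tail t ts ts' s m p h ih =>
    have hb := h.rot.bounds
    have ht := numLeaves_pos' t
    have hr := rootEdge_bounds t s
    obtain ⟨A, B, C, a, b, c, h1, h2, h3⟩ := ih (P := s) (by omega) (by omega)
    have hl : leaves [t] = t.numLeaves := by simp [leaves]
    have hm : cycles P s [t] = _ :=
      (map_cycles (e := 2 * m) (e' := 2 * p) (by omega) (by omega)
        (by omega)).symm
    refine ⟨cycles P s [t] ++ A, B, C, a, b, c, ?_, ?_, h3⟩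
    · simp [cycles, h1]
    · rw [cycles, h2, List.map_append, ← hm]
      simp [cycles]

/-- Both contractions produce the four-valent vertex whose cyclic order is: edge from below, then
the stems of the right, middle and left branches. Since `m` precedes `p` in both lists while the
contracted edge points from `p` to `m` in one graph and from `m` to `p` in the other, the
orientations are opposite. -/
theorem contraction_of_rightRot {k : ℕ} (hk : 0 < k) {ts ts' : List PlanarTree}
    (hts : leaves ts = k) (hts' : leaves ts' = k) {m p : ℕ}
    (h : OnEntry RightRot ts 0 m p ts') :
    (graph hk ts hts).contraction (2 * m) = -(graph hk ts' hts').contraction (2 * p) := by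
  have hb := h.rot.bounds
  have hb' := h.rot.symm.bounds
  -- `lastRoot 0 0 ts` is either a root or the default value `0`; an internal vertex is neither.
  have hP : ∀ q, 0 < q → q ∉ roots 0 ts → lastRoot 0 0 ts ≠ q := by
    rintro q hq h1 rfl
    rcases List.mem_cons.1 (lastRoot_mem 0 0 ts) with h2 | h2
    · omega
    · exact h1 h2
  have hP' : ∀ q, 0 < q → q ∉ roots 0 ts' → lastRoot 0 0 ts' ≠ q := by
    rintro q hq h1 rfl
    rcases List.mem_cons.1 (lastRoot_mem 0 0 ts') with h2 | h2
    · omega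
    · exact h1 h2
  have hl := lastRoot_congr hb.2.2.2.2.2.2.2 0 0
  obtain ⟨A, B, C, a, b, c, h1, h2, h3⟩ := h.exists_cycles (P := lastRoot 0 0 ts)
    (hP m hb.1 hb.2.2.2.2.2.1) (hl ▸ hP' p hb'.1 hb'.2.2.2.2.2.1)
  simp only [List.mem_cons, List.not_mem_nil, or_false, forall_eq_or_imp, forall_eq] at h3
  obtain ⟨ha, hb1, hc⟩ := h3
  have hmp : 2 * m ≠ 2 * p := by omega
  refine RibbonGraph.contraction_eq_neg_of_lists (X := graph hk ts hts)
    (Y := graph hk ts' hts') rfl ((ofFn_cyc_graph hk ts hts).trans h1)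
    ((ofFn_cyc_graph hk ts' hts').trans (hl ▸ h2)) (by simp) (by simp) (by simp) (by simp) ?_
  have e1 : after (2 * p, false) [(2 * m, true), (2 * p, false), (a, false)] =
      [(a, false), (2 * m, true)] := by
    simp [after]
  have e2 : after (2 * p, true) [(2 * p, true), (c, false), (b, false)] =
      [(c, false), (b, false)] := by
    simp [after]
  have e3 : after (2 * m, false) [(2 * p, true), (c, false), (2 * m, false)] =
      [(2 * p, true), (c, false)] := by
    simp [after, hc.1]
  have e4 : after (2 * m, true) [(2 * m, true), (b, false), (a, false)] =
      [(b, false), (a, false)] := by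
    simp [after]
  rw [e1, e2, e3, e4]
  simp only [List.cons_append, List.nil_append, List.map_cons, List.map_nil, swapEdges,
    Equiv.swap_apply_right, Equiv.swap_apply_of_ne_of_ne ha.1 ha.2,
    Equiv.swap_apply_of_ne_of_ne hb1.1 hb1.2, Equiv.swap_apply_of_ne_of_ne hc.1 hc.2]
  exact ⟨1, rfl⟩

theorem contraction_of_rot {k : ℕ} (hk : 0 < k) {ts ts' : List PlanarTree}
    (hts : leaves ts = k) (hts' : leaves ts' = k) {m p : ℕ} (h : OnEntry Rot ts 0 m p ts') :
    (graph hk ts' hts').contraction (2 * p) = -(graph hk ts hts).contraction (2 * m) := by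
  rcases h.rightRot with h | h
  · rw [contraction_of_rightRot hk hts hts' h, neg_neg]
  · exact contraction_of_rightRot hk hts' hts h

/-- Send an interior edge to the one created by its rotation. The inverse rotation at the new edge
leads back, and uniqueness of rotations makes this the value of the chosen map. -/
theorem exists_involution {k : ℕ} (hk : 0 < k) (c : Composition k) :
    ∃ f : (Σ ts : TreeChoice c.blocks, {e : ℕ // e ∈ interiorEdges ts.1}) →
        (Σ ts : TreeChoice c.blocks, {e : ℕ // e ∈ interiorEdges ts.1}),
      Function.Involutive f ∧ ∀ x, f x ≠ x ∧
        (summand hk c (f x).1).contraction (f x).2 = -(summand hk c x.1).contraction x.2 := by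
  have key : ∀ x : (Σ ts : TreeChoice c.blocks, {e : ℕ // e ∈ interiorEdges ts.1}),
      ∃ y : (Σ ts : TreeChoice c.blocks, {e : ℕ // e ∈ interiorEdges ts.1}), ∃ m p,
        (x.2 : ℕ) = 2 * m ∧ (y.2 : ℕ) = 2 * p ∧ OnEntry Rot x.1.1 0 m p y.1.1 := by
    rintro ⟨⟨ts, hts⟩, e, he⟩
    obtain ⟨m, p, ts', rfl, h⟩ := mem_interiorEdges_iff.1 he
    exact ⟨⟨⟨ts', h.bounds.2.2.2.2.2.2.2.trans hts⟩, 2 * p,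
      mem_interiorEdges_iff.2 ⟨p, m, ts, rfl, h.symm⟩⟩, m, p, rfl, rfl, h⟩
  choose f hf using key
  refine ⟨f, fun x => ?_, fun x => ⟨fun h => ?_, ?_⟩⟩
  · obtain ⟨m, p, h1, h2, h3⟩ := hf x
    obtain ⟨m', p', h1', h2', h3'⟩ := hf (f x)
    obtain rfl : m' = p := by omega
    obtain ⟨h4, h5⟩ := h3'.unique h3.symm
    generalize f (f x) = y at *
    obtain ⟨⟨ts, hts⟩, e, he⟩ := x
    obtain ⟨⟨ts', hts'⟩, e', he'⟩ := y
    dsimp only at *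
    subst h5 h4
    obtain rfl : e' = e := by omega
    rfl
  -- A fixed point would require `m = p`, but these are a child and its parent.
  · obtain ⟨m, p, h1, h2, h3⟩ := hf x
    rw [h] at h2
    have := h3.bounds
    omega
  · obtain ⟨m, p, h1, h2, h3⟩ := hf x
    rw [h1, h2]
    exact contraction_of_rot hk _ _ h3

end Necklace

/-! ### Edges from the tops of the trees: cut vertices after contraction. -/

theorem after_append_cons {α : Type*} [DecidableEq α] {h : α} {l₁ l₂ : List α} (hl : h ∉ l₁) :
    after h (l₁ ++ h :: l₂) = l₂ ++ l₁ := by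
  rw [after, List.idxOf_append_of_notMem hl, List.idxOf_cons_self, Nat.add_zero]
  congr 1
  · rw [List.drop_append]
    simp
  · simp

namespace RibbonGraph

/-- A criterion that can be checked before contracting: the merged vertex itself is the cut vertex,
and all other vertices are those of `X`. -/
theorem contract_hasCutVertex {n : ℕ} {X : RibbonGraph n} {e : ℕ} {a b : Fin n} (hab : a ≠ b)
    (ha : (e, false) ∈ X.cyc a) (hb : (e, true) ∈ X.cyc b) {A B : List HalfEdge} {S : Set ℕ}
    (hr : after (e, false) (X.cyc a) ++ after (e, true) (X.cyc b) ~r A ++ B) (hA : A ≠ [])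
    (hB : B ≠ []) (hAS : ∀ h ∈ A, h.1 ∈ S) (hBS : ∀ h ∈ B, h.1 ∉ S)
    (hS : ∀ i, i ≠ a → i ≠ b → (∀ h ∈ X.cyc i, h.1 ∈ S) ∨ (∀ h ∈ X.cyc i, h.1 ∉ S)) :
    (X.contract e a b hab ha hb).HasCutVertex := by
  match n, X, a, b, hab, ha, hb, hr, hS with
  | 0, _, a, _, _, _, _, _, _ => exact a.elim0
  | 1, _, a, b, hab, _, _, _, _ => exact absurd (Subsingleton.elim a b) hab
  | n + 2, X, a, b, hab, ha, hb, hr, hS =>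
    set π := bringToFront a b with hπ
    have π0 : π.symm 0 = a := by rw [Equiv.symm_apply_eq, hπ, bringToFront_left hab]
    have π1 : π.symm 1 = b := by rw [Equiv.symm_apply_eq, hπ, bringToFront_right]
    refine ⟨(0 : Fin (n + 1)), A, B, S, ?_, hA, hB, hAS, hBS,
      Fin.cases (fun h => absurd rfl h) fun j _ => ?_⟩
    · simp only [contract, contractFirst, Fin.cons_zero, relabel, ← hπ, π0, π1]
      exact hr
    · simp only [contract, contractFirst, Fin.cons_succ, relabel, ← hπ]
      refine hS _ (fun h => ?_) fun h => ?_
      · rw [← π0, π.symm.injective.eq_iff] at h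
        exact Fin.succ_ne_zero _ h
      · rw [← π1, π.symm.injective.eq_iff] at h
        exact Fin.succ_ne_zero j (Fin.succ_injective _ h)

end RibbonGraph

namespace Necklace

open BinaryTree

/-- The ends at the root of the edges from the leaves `s, …, s + n - 1`. -/
def strands (s n : ℕ) : List HalfEdge := (List.range' s n).map fun u => (leafEdge u, true)

theorem strands_append (s m n : ℕ) : strands s m ++ strands (s + m) n = strands s (m + n) := by
  rw [strands, strands, ← List.map_append, List.range'_append_1, strands]

theorem strands_succ (s n : ℕ) : strands s (n + 1) = (leafEdge s, true) :: strands (s + 1) n := by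
  rw [strands, List.range'_succ, List.map_cons, strands]

theorem mem_strands {s n : ℕ} {h : HalfEdge} :
    h ∈ strands s n ↔ ∃ u, s ≤ u ∧ u < s + n ∧ h = (2 * u + 1, true) := by
  simp only [strands, leafEdge, List.mem_map, List.mem_range'_1, and_assoc, eq_comm]

/-- Read from the strand of `u`: the `M` strands to its right, the three edges of the large loop and
the stem, then the `d` strands to its left. -/
theorem after_rootCycle {P s u d M : ℕ} {t : PlanarTree} (hu : u = s + d)
    (ht : t.numLeaves = d + (M + 1)) (hn : (rootCycle P s t).Nodup) :
    after (leafEdge u, true) (rootCycle P s t) = strands (u + 1) M ++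
      ([(loopEdge s, false), (rootEdge t s, false), (loopEdge P, true)] ++ strands s d) := by
  have h1 : rootCycle P s t = ([(loopEdge s, false), (rootEdge t s, false),
      (loopEdge P, true)] ++ strands s d) ++ ((leafEdge u, true) :: strands (u + 1) M) := by
    rw [hu, ← strands_succ, List.append_assoc, strands_append, ← ht]
    rfl
  refine after_eq hn (by rw [h1]; simp) ?_
  rw [h1]
  exact List.isRotated_append

/-- The subtree `R` is the other branch at the parent of the leaf `u`, and `v` is its first leaf. If
`R` lies to the right, the parent has the number `v = u + 1`; if it lies to the left, the parent has
the number `u`. In both cases the leaves of `R` are adjacent to `u`. -/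
theorem exists_sibling {t : PlanarTree} (ht : t ≠ nil) {s u : ℕ} (h1 : s ≤ u)
    (h2 : u < s + t.numLeaves) : ∃ (R : PlanarTree) (v : ℕ),
      (∀ l ∈ nodeCycles R v, l ∈ nodeCycles t s) ∧ s ≤ v ∧
      v + R.numLeaves ≤ s + t.numLeaves ∧
      ((v = u + 1 ∧ [(2 * v, true), (rootEdge R v, false), (2 * u + 1, false)] ∈
        nodeCycles t s) ∨
      (v + R.numLeaves = u ∧ [(2 * u, true), (2 * u + 1, false), (rootEdge R v, false)] ∈
        nodeCycles t s)) := by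
  induction t generalizing s with
  | nil => exact absurd rfl ht
  | node _ l r hl hr =>
    simp only [numLeaves] at h2 ⊢
    by_cases h : u < s + l.numLeaves
    · by_cases hn : l = nil
      · subst hn
        simp only [numLeaves] at h
        obtain rfl : u = s := by omega
        refine ⟨r, u + 1, fun l hl => by simp [nodeCycles, hl], by omega,
          by simp only [numLeaves]; omega, .inl ⟨rfl, ?_⟩⟩
        simp [nodeCycles, nodeEdge, rootEdge, leafEdge]
      · obtain ⟨R, v, hR, h3, h4, h5⟩ := hl hn h1 h
        refine ⟨R, v, fun l hl => ?_, h3, by omega, ?_⟩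
        · simp [nodeCycles, hR l hl]
        · simp only [nodeCycles, List.mem_append]
          exact h5.imp (fun h => ⟨h.1, .inl h.2⟩) (fun h => ⟨h.1, .inl h.2⟩)
    · by_cases hn : r = nil
      · subst hn
        simp only [numLeaves] at h2
        obtain rfl : u = s + l.numLeaves := by omega
        refine ⟨l, s, ?_, by omega, by omega, .inr ⟨rfl, ?_⟩⟩ <;>
          simp +contextual [nodeCycles, nodeEdge, rootEdge, leafEdge]
      · obtain ⟨R, v, hR, h3, h4, h5⟩ := hr hn (s := s + l.numLeaves) (by omega) (by omega)
        refine ⟨R, v, fun l hl => ?_, by omega, by omega, ?_⟩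
        · simp [nodeCycles, hR l hl]
        · simp only [nodeCycles, List.mem_append, List.mem_cons]
          exact h5.imp (fun h => ⟨h.1, .inr (.inr h.2)⟩) (fun h => ⟨h.1, .inr (.inr h.2)⟩)

theorem exists_entry_of_leaf {ts : List PlanarTree} {P s u : ℕ} (h1 : s ≤ u)
    (h2 : u < s + leaves ts) : ∃ (t : PlanarTree) (Q v : ℕ), rootCycle Q v t ∈ cycles P s ts ∧
      (∀ l ∈ nodeCycles t v, l ∈ cycles P s ts) ∧ v ≤ u ∧ u < v + t.numLeaves := by
  induction ts generalizing P s with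
  | nil => simp [leaves] at h2; omega
  | cons t ts ih =>
    rw [leaves_cons] at h2
    by_cases h : u < s + t.numLeaves
    · exact ⟨t, P, s, by simp [cycles], fun l hl => by simp [cycles, hl], h1, h⟩
    · obtain ⟨t', Q, v, h3, h4, h5⟩ := ih (P := s) (s := s + t.numLeaves) (by omega) (by omega)
      exact ⟨t', Q, v, by simp [cycles, h3], fun l hl => by simp [cycles, h4 l hl], h5⟩

/-- Where the half-edges of a subtree are. -/
theorem mem_subtree {R : PlanarTree} {v : ℕ} {h : HalfEdge} (h1 : 2 * v < h.1)
    (h2 : h.1 < 2 * (v + R.numLeaves)) : (∃ l ∈ nodeCycles R v, h ∈ l) ∨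
      (h = (rootEdge R v, false)) ∨ (h.2 = true ∧ h.1 % 2 = 1) := by
  obtain ⟨x, b⟩ := h
  dsimp only at *
  by_contra! hne
  obtain ⟨h3, h4, h5⟩ := hne
  have h6 := count_nodeCycles R v x b
  rw [List.count_eq_zero.2 (fun hm => by
    obtain ⟨l, hl, hl'⟩ := List.mem_flatten.1 hm
    exact h3 l hl hl')] at h6
  have h7 : ¬ (x = rootEdge R v ∧ b = false) := fun h => h4 (by rw [h.1, h.2])
  rw [if_neg h7] at h6
  cases b
  · simp only [true_and] at h6
    split_ifs at h6 <;> omega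
  · simp only [reduceCtorEq, false_and, if_false, true_implies] at h5 h6
    split_ifs at h6 <;> omega

theorem contract_topEdge_hasCutVertex {k : ℕ} (hk : 0 < k) {ts : List PlanarTree}
    (hts : leaves ts = k) {e : ℕ} {a b : Fin k} (hab : a ≠ b)
    (ha : (e, false) ∈ (graph hk ts hts).cyc a) (hb : (e, true) ∈ (graph hk ts hts).cyc b)
    (he : e ∈ topEdges ts) : ((graph hk ts hts).contract e a b hab ha hb).HasCutVertex := by
  simp only [topEdges, Finset.mem_image, Finset.mem_range] at he
  obtain ⟨u, hu, rfl⟩ := he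
  obtain ⟨t, P, s, hroot, hnode, hsu, hut⟩ := exists_entry_of_leaf (ts := ts)
    (P := lastRoot 0 0 ts) (s := 0) (Nat.zero_le u) (by omega)
  obtain ⟨b', hb'⟩ : ∃ i, (graph hk ts hts).cyc i = rootCycle P s t :=
    exists_vertexCycle ts hts hroot
  have hmem : (leafEdge u, true) ∈ rootCycle P s t := by
    simp only [rootCycle, List.mem_cons, List.mem_map, List.mem_range'_1]
    exact .inr (.inr (.inr ⟨u, ⟨hsu, hut⟩, rfl⟩))
  obtain rfl : b' = b := (graph hk ts hts).vertex_unique (hb' ▸ hmem) hb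
  -- The top edge of a one-leaf tree is also its root edge and returns to the root, so it is a loop.
  have hnil : t ≠ nil := by
    rintro rfl
    simp only [numLeaves] at hut
    obtain rfl : u = s := by omega
    refine hab ((graph hk ts hts).vertex_unique ha ?_)
    rw [hb']
    simp [rootCycle, rootEdge]
  obtain ⟨R, v, hR, hsv, hvt, hcase⟩ := exists_sibling hnil hsu hut
  -- The edges of `R`, including its stem and its top edges. The stem of `R` starts at the parent
  -- `a` and the strands end at the root `b'`, so only these two vertices can see both sides.
  set S : Set ℕ := {x | 2 * v < x ∧ x < 2 * (v + R.numLeaves)} with hS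
  have huS : leafEdge u ∉ S := by
    simp only [hS, leafEdge, Set.mem_ofPred_eq]
    omega
  have hRS : ∀ i, (graph hk ts hts).cyc i ∈ nodeCycles R v →
      ∀ h ∈ (graph hk ts hts).cyc i, h.1 ∈ S :=
    fun i hi h hh => mem_nodeCycles_bounds hi hh
  have hrR : rootEdge R v ∈ S := rootEdge_bounds R v
  have hra : (rootEdge R v, false) ∈ (graph hk ts hts).cyc a := by
    rcases hcase with ⟨-, h⟩ | ⟨-, h⟩
    all_goals
      obtain ⟨i, hi⟩ : ∃ i, (graph hk ts hts).cyc i = _ :=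
        exists_vertexCycle ts hts (hnode _ h)
      obtain rfl : i = a := (graph hk ts hts).vertex_unique (by rw [hi]; simp [leafEdge]) ha
      rw [hi]
      simp
  have hsub : ∀ i, ∀ h ∈ (graph hk ts hts).cyc i, h.1 ∈ S →
      (graph hk ts hts).cyc i ∈ nodeCycles R v ∨ i = a ∨ (h.2 = true ∧ h.1 % 2 = 1) := by
    intro i h hh hhS
    rcases mem_subtree hhS.1 hhS.2 with ⟨l, hl, hhl⟩ | rfl | h3
    · obtain ⟨j, rfl⟩ := exists_vertexCycle ts hts (hnode l (hR l hl))
      rw [(graph hk ts hts).vertex_unique hh (j := j) hhl]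
      exact .inl hl
    · exact .inr (.inl ((graph hk ts hts).vertex_unique hh hra))
    · exact .inr (.inr h3)
  have hbS : ∀ h ∈ rootCycle P s t, h.1 ∈ S → h.2 = true ∧ h.1 % 2 = 1 := by
    intro h hh hhS
    rcases hsub b' h (hb' ▸ hh) hhS with h1 | h1 | h1
    · exact absurd (hRS b' h1 _ hb) huS
    · exact absurd h1.symm hab
    · exact h1
  -- At the root, edges of `S` appear only as incoming odd-labelled strands; two of these half-edges
  -- are outgoing and the third has an even label.
  have hoS : ∀ h ∈ [(loopEdge s, false), (rootEdge t s, false), (loopEdge P, true)],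
      h.1 ∉ S := by
    intro h hh hhS
    have h1 := hbS h (by
      simp only [List.mem_cons, List.not_mem_nil, or_false] at hh
      rcases hh with rfl | rfl | rfl <;> simp [rootCycle]) hhS
    simp only [List.mem_cons, List.not_mem_nil, or_false] at hh
    rcases hh with rfl | rfl | rfl <;> simp [loopEdge] at h1
  have hst : ∀ c d, (c + d ≤ v ∨ v + R.numLeaves ≤ c) → ∀ h ∈ strands c d, h.1 ∉ S := by
    rintro c d hcd h hh ⟨h1, h2⟩
    obtain ⟨w, h3, h4, rfl⟩ := mem_strands.1 hh
    dsimp only at h1 h2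
    omega
  have hstR : ∀ h ∈ strands v R.numLeaves, h.1 ∈ S := by
    intro h hh
    obtain ⟨w, h3, h4, rfl⟩ := mem_strands.1 hh
    simp only [hS, Set.mem_ofPred_eq]
    omega
  have hother : ∀ i, i ≠ a → i ≠ b' → (∀ h ∈ (graph hk ts hts).cyc i, h.1 ∈ S) ∨
      (∀ h ∈ (graph hk ts hts).cyc i, h.1 ∉ S) := by
    intro i hia hib
    by_cases hi : (graph hk ts hts).cyc i ∈ nodeCycles R v
    · exact .inl (hRS i hi)
    · refine .inr fun h hh hhS => ?_
      rcases hsub i h hh hhS with h1 | h1 | ⟨h1, h2⟩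
      · exact hi h1
      · exact hia h1
      · refine hib ((graph hk ts hts).vertex_unique hh ?_)
        rw [hb']
        simp only [rootCycle, List.mem_cons, List.mem_map, List.mem_range'_1]
        refine .inr (.inr (.inr ⟨h.1 / 2, ?_, ?_⟩))
        · obtain ⟨h3, h4⟩ := hhS
          omega
        · rw [leafEdge]
          ext
          · dsimp only; omega
          · exact h1.symm
  have hn : (rootCycle P s t).Nodup := hb' ▸ (graph hk ts hts).nodup b'
  obtain ⟨d, hd⟩ := Nat.exists_eq_add_of_le hsu
  obtain ⟨M, hM⟩ := Nat.exists_eq_add_of_lt hut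
  have haft := after_rootCycle (M := M) hd (by omega) hn
  -- The edge entering the parent from below is `2 * v` or `2 * (v + R.numLeaves)`, just outside the
  -- open interval defining `S`.
  have hu2 : 2 * v ∉ S ∧ 2 * (v + R.numLeaves) ∉ S := by simp [hS]
  rcases hcase with ⟨rfl, hx⟩ | ⟨huv, hx⟩
  · obtain ⟨i, hi⟩ : ∃ i, (graph hk ts hts).cyc i = _ := exists_vertexCycle ts hts (hnode _ hx)
    obtain rfl : i = a := (graph hk ts hts).vertex_unique (by rw [hi]; simp [leafEdge]) ha
    obtain ⟨N, rfl⟩ : ∃ N, M = R.numLeaves + N := ⟨M - R.numLeaves, by omega⟩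
    have hru : (leafEdge u, false) ∉ [(2 * (u + 1), true), (rootEdge R (u + 1), false)] := by
      simp only [List.mem_cons, Prod.mk.injEq, Bool.false_eq_true, and_false, and_true,
        List.not_mem_nil, or_false, false_or]
      exact fun h => huS (h ▸ hrR)
    -- Sibling on the right: at the parent its stem comes last before the contracted half-edge, and
    -- at the root its strands come first after it, so splicing makes them consecutive.
    refine RibbonGraph.contract_hasCutVertex hab ha hb (S := S)
      (A := (rootEdge R (u + 1), false) :: strands (u + 1) R.numLeaves)
      (B := strands (u + 1 + R.numLeaves) N ++ ([(loopEdge s, false), (rootEdge t s, false),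
        (loopEdge P, true)] ++ strands s d) ++ [(2 * (u + 1), true)])
      ?_ (by simp) (by simp) ?_ ?_ hother
    · rw [hi, hb', haft, ← strands_append]
      rw [show after (leafEdge u, false) [(2 * (u + 1), true), (rootEdge R (u + 1), false),
        (2 * u + 1, false)] = [(2 * (u + 1), true), (rootEdge R (u + 1), false)] from
          after_append_cons hru]
      exact ⟨1, by simp⟩
    · intro h hh
      rcases List.mem_cons.1 hh with rfl | hh
      · exact hrR
      · exact hstR h hh
    · intro h hh
      simp only [List.mem_append] at hh
      rcases hh with (hh | hh | hh) | hh
      · exact hst _ _ (by omega) h hh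
      · exact hoS h hh
      · exact hst _ _ (by omega) h hh
      · rw [List.mem_singleton.1 hh]
        exact hu2.1
  · obtain ⟨i, hi⟩ : ∃ i, (graph hk ts hts).cyc i = _ := exists_vertexCycle ts hts (hnode _ hx)
    obtain rfl : i = a := (graph hk ts hts).vertex_unique (by rw [hi]; simp [leafEdge]) ha
    obtain ⟨c, rfl⟩ := Nat.exists_eq_add_of_le hsv
    obtain rfl : d = c + R.numLeaves := by omega
    -- Sibling on the left: its strands end the sequence at the root and its stem begins the one at
    -- the parent, so they are consecutive across the other junction.
    refine RibbonGraph.contract_hasCutVertex hab ha hb (S := S)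
      (A := strands (s + c) R.numLeaves ++ [(rootEdge R (s + c), false)])
      (B := (2 * u, true) :: (strands (u + 1) M ++ ([(loopEdge s, false),
        (rootEdge t s, false), (loopEdge P, true)] ++ strands s c)))
      ?_ (by simp) (by simp) ?_ ?_ hother
    · rw [hi, hb', haft, ← strands_append]
      rw [show after (leafEdge u, false) [(2 * u, true), (2 * u + 1, false),
        (rootEdge R (s + c), false)] = [(rootEdge R (s + c), false), (2 * u, true)] by
          simp [after, leafEdge]]
      have := List.isRotated_append (l := (rootEdge R (s + c), false) :: (2 * u, true) ::
        (strands (u + 1) M ++ ([(loopEdge s, false), (rootEdge t s, false),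
          (loopEdge P, true)] ++ strands s c))) (l' := strands (s + c) R.numLeaves)
      simpa using this
    · intro h hh
      rcases List.mem_append.1 hh with hh | hh
      · exact hstR h hh
      · rw [List.mem_singleton.1 hh]
        exact hrR
    · intro h hh
      simp only [List.mem_cons, List.mem_append (s := strands (u + 1) M),
        List.mem_append (t := strands s c)] at hh
      rcases hh with rfl | hh | hh | hh
      · rw [← huv]
        exact hu2.2
      · exact hst _ _ (by omega) h hh
      · exact hoS h (by simpa using hh)
      · exact hst _ _ (by omega) h hh

end Necklace

/-! ### The reduced boundary of an ornate necklace. -/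

theorem reducedBoundaryMap_reduce (k : ℕ) (x : RG k) :
    reducedBoundaryMap k (reduce k x) = reduce (k - 1) (boundaryMap k x) := rfl

theorem reduce_toRG_of_hasCutVertex {n : ℕ} {X : RibbonGraph n} (hX : X.HasCutVertex) :
    reduce n X.toRG = 0 := by
  rw [reduce, Submodule.mkQ_apply, Submodule.Quotient.mk_eq_zero]
  exact Submodule.subset_span ⟨X, hX, rfl⟩

theorem eq_zero_of_eq_neg {V : Type*} [AddCommGroup V] [Module ℚ V] {x : V} (h : x = -x) :
    x = 0 := by
  have h2 : (2 : ℚ) • x = 0 := by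
    rw [two_smul]
    nth_rewrite 2 [h]
    rw [add_neg_cancel]
  exact (smul_eq_zero.1 h2).resolve_left two_ne_zero

namespace Necklace

open BinaryTree

theorem rootEdges_subset (ts : List PlanarTree) :
    rootEdges ts ⊆ Finset.range (2 * leaves ts) := by
  intro x hx
  have := rootEdgeList_bounds (List.mem_toFinset.1 hx)
  rw [Finset.mem_range]
  omega

theorem loopEdges_subset (ts : List PlanarTree) :
    loopEdges ts ⊆ Finset.range (2 * leaves ts) := by
  intro x hx
  obtain ⟨y, hy, rfl⟩ := List.mem_map.1 (List.mem_toFinset.1 hx)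
  have := roots_bounds hy
  rw [Finset.mem_range, loopEdge]
  omega

theorem topEdges_subset (ts : List PlanarTree) :
    topEdges ts ⊆ Finset.range (2 * leaves ts) := by
  intro x hx
  simp only [topEdges, Finset.mem_image, Finset.mem_range, leafEdge] at hx ⊢
  omega

theorem reduce_contraction_topEdge {k : ℕ} (hk : 0 < k) {ts : List PlanarTree}
    (hts : leaves ts = k) {e : ℕ} (he : e ∈ topEdges ts) :
    reduce (k - 1) ((graph hk ts hts).contraction e) = 0 := by
  have hmem : e ∈ (graph hk ts hts).edges := by
    have := topEdges_subset ts he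
    rwa [hts] at this
  obtain ⟨a, ha⟩ := (graph hk ts hts).exists_vertex (h := (e, false)) hmem
  obtain ⟨b, hb⟩ := (graph hk ts hts).exists_vertex (h := (e, true)) hmem
  by_cases hab : a = b
  · subst hab
    rw [RibbonGraph.contraction_of_eq _ ha hb, map_zero]
  · rw [RibbonGraph.contraction_eq _ hab ha hb, map_smul, reduce_toRG_of_hasCutVertex
      (contract_topEdge_hasCutVertex hk hts hab ha hb he), smul_zero]

/-- Reindexing by the involution turns the sum into its own negative, and the coefficients are
rational. -/
theorem sum_interiorEdges {k : ℕ} (hk : 0 < k) (c : Composition k) :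
    ∑ ts : TreeChoice c.blocks, ∑ e ∈ interiorEdges ts.1, (summand hk c ts).contraction e = 0 := by
  obtain ⟨f, hf, h⟩ := exists_involution hk c
  have h1 : ∑ ts : TreeChoice c.blocks, ∑ e ∈ interiorEdges ts.1,
      (summand hk c ts).contraction e =
        ∑ x : (Σ ts : TreeChoice c.blocks, {e : ℕ // e ∈ interiorEdges ts.1}),
          (summand hk c x.1).contraction x.2 := by
    rw [Fintype.sum_sigma]
    exact Finset.sum_congr rfl fun ts _ =>
      (Finset.sum_coe_sort (interiorEdges ts.1) fun e => (summand hk c ts).contraction e).symm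
  rw [h1]
  refine eq_zero_of_eq_neg ?_
  rw [← Finset.sum_neg_distrib]
  exact (Equiv.sum_comp hf.toPerm _).symm.trans (Finset.sum_congr rfl fun x _ => (h x).2)

theorem reducedBoundary_ornate {k : ℕ} (hk : 0 < k) (c : Composition k) :
    reducedBoundaryMap k (reduce k (ornate hk c)) =
      ∑ ts : TreeChoice c.blocks, ∑ e ∈ rootEdges ts.1 ∪ loopEdges ts.1,
        reduce (k - 1) ((summand hk c ts).contraction e) := by
  have h0 := congrArg (reduce (k - 1)) (sum_interiorEdges hk c)
  rw [map_zero, map_sum] at h0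
  rw [reducedBoundaryMap_reduce, ornate, map_sum, map_sum]
  -- The vanishing interior sum is added on the right, so that the two sides can be compared summand
  -- by summand.
  conv_rhs => rw [← zero_add (∑ _, _), ← h0, ← Finset.sum_add_distrib]
  refine Finset.sum_congr rfl fun ts _ => ?_
  have hts : leaves ts.1 = k := by rw [leaves, ts.2, c.blocks_sum]
  rw [boundaryMap_toRG, RibbonGraph.boundary, map_sum, map_sum]
  have hsub : loopEdges ts.1 ∪ rootEdges ts.1 ∪ topEdges ts.1 ⊆
      Finset.range (2 * leaves ts.1) :=
    Finset.union_subset (Finset.union_subset (loopEdges_subset _) (rootEdges_subset _))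
      (topEdges_subset _)
  have h1 := Finset.sum_sdiff hsub (f := fun e =>
    reduce (k - 1) ((summand hk c ts).contraction e))
  rw [show (summand hk c ts).edges = Finset.range (2 * leaves ts.1) by rw [hts]; rfl, ← h1]
  congr 1
  rw [show rootEdges ts.1 ∪ loopEdges ts.1 = _ from Finset.union_comm _ _]
  -- Top edges need not be disjoint from root edges, since a one-leaf tree has one edge of both
  -- kinds; only the top edges outside the union are discarded.
  exact (Finset.sum_subset (f := fun e => reduce (k - 1) ((summand hk c ts).contraction e))
    (Finset.subset_union_left (s₁ := loopEdges ts.1 ∪ rootEdges ts.1) (s₂ := topEdges ts.1))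
    fun e he hne => reduce_contraction_topEdge hk hts
      ((Finset.mem_union.1 he).resolve_left hne)).symm

/-! ### Loop edges and root edges of joined trees. -/

/-- Joining two trees renames the loop edge leaving them from `2 * q` to `0`. This affects the edge
arriving at the first root only if there are no further trees; otherwise the last root lies beyond
both. -/
theorem swap_lastRoot {q s : ℕ} (hq : 0 < q) (hs : q < s) (ts : List PlanarTree) :
    Equiv.swap 0 (2 * q) (2 * lastRoot q s ts) = 2 * lastRoot 0 s ts := by
  cases ts with
  | nil => simp [lastRoot]
  | cons t ts =>
    simp only [lastRoot]
    have h : s ≤ lastRoot s (s + t.numLeaves) ts := by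
      rcases List.mem_cons.1 (lastRoot_mem s (s + t.numLeaves) ts) with h | h
      · exact h.ge
      · have := roots_bounds h
        omega
    rw [Equiv.swap_apply_of_ne_of_ne] <;> omega

/-- Among the remaining trees only the first one sees the renamed edge, as its incoming loop edge.
-/
theorem map_swapEdges_cycles {q s : ℕ} (hq : 0 < q) (hs : q < s) (ts : List PlanarTree) :
    (cycles q s ts).map (List.map (swapEdges 0 (2 * q))) = cycles 0 s ts := by
  cases ts with
  | nil => rfl
  | cons t ts =>
    have ht := numLeaves_pos' t
    have hr := rootEdge_bounds t s
    rw [cycles, cycles, List.map_append, List.map_cons, map_nodeCycles (by omega) (by omega),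
      map_cycles (by omega) (by omega) (by omega)]
    simp only [rootCycle, List.map_cons, loopEdge]
    rw [map_swapEdges (l := List.map _ _)]
    · simp only [swapEdges]
      rw [Equiv.swap_apply_of_ne_of_ne (x := 2 * s) (by omega) (by omega),
        Equiv.swap_apply_of_ne_of_ne (x := rootEdge t s) (by omega) (by omega),
        Equiv.swap_apply_right]
    · intro x hx
      simp only [leafEdge, List.mem_map] at hx
      obtain ⟨u, hu, rfl⟩ := hx
      dsimp only
      omega

theorem map_swapEdges_strands (e e' s n : ℕ) :
    (strands s n).map (swapEdges (2 * e) (2 * e')) = strands s n := by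
  refine map_swapEdges fun x hx => ?_
  obtain ⟨u, -, -, rfl⟩ := mem_strands.1 hx
  dsimp only
  omega

theorem rootCycle_eq (P s : ℕ) (t : PlanarTree) : rootCycle P s t =
    (2 * s, false) :: (rootEdge t s, false) :: (2 * P, true) :: strands s t.numLeaves := rfl

/-- The lowest internal vertex of the joined tree takes over the number `q` of the second root, and
every other vertex keeps its position. Both contracted edges run from vertex `0` to vertex `q`, so
the sign is `+`. The strands of the two trees become adjacent in their left-to-right order. -/
theorem contraction_loopEdge_eq {k : ℕ} (hk : 0 < k) (t₁ t₂ : PlanarTree)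
    (ts : List PlanarTree) (hA : leaves (t₁ :: t₂ :: ts) = k)
    (hB : leaves (node () t₁ t₂ :: ts) = k) :
    (graph hk (t₁ :: t₂ :: ts) hA).contraction (loopEdge 0) =
      (graph hk (node () t₁ t₂ :: ts) hB).contraction (rootEdge (node () t₁ t₂) 0) := by
  have h1 := numLeaves_pos' t₁
  have h2 := numLeaves_pos' t₂
  set q := t₁.numLeaves with hq
  have r1 := rootEdge_bounds t₁ 0
  have r2 := rootEdge_bounds t₂ q
  have hlast := swap_lastRoot h1 (show q < q + t₂.numLeaves by omega) ts
  have hcyc := map_swapEdges_cycles h1 (show q < q + t₂.numLeaves by omega) ts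
  set P := lastRoot q (q + t₂.numLeaves) ts with hP
  set P' := lastRoot 0 (q + t₂.numLeaves) ts with hP'
  have he : rootEdge (node () t₁ t₂) 0 = 2 * q := by simp [rootEdge, nodeEdge, hq]
  rw [he]
  have hx : (graph hk (t₁ :: t₂ :: ts) hA).contraction (2 * 0) =
      (graph hk (node () t₁ t₂ :: ts) hB).contraction (2 * q) := by
    refine RibbonGraph.contraction_eq_of_lists (A := []) (B := nodeCycles t₁ 0)
      (C := nodeCycles t₂ q ++ cycles q (q + t₂.numLeaves) ts)
      (x := rootCycle P 0 t₁) (y := rootCycle 0 q t₂)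
      (x' := rootCycle P' 0 (node () t₁ t₂))
      (y' := [(2 * q, true), (rootEdge t₂ q, false), (rootEdge t₁ 0, false)])
      rfl ?_ ?_ ?_ ?_ ?_ ?_ ?_
    · rw [ofFn_cyc_graph]
      simp [cycles, lastRoot, ← hq, ← hP]
    · rw [ofFn_cyc_graph, map_nodeCycles (by omega) (by omega), List.map_append,
        map_nodeCycles (by omega) (by omega), Nat.mul_zero, hcyc]
      simp [cycles, lastRoot, ← hq, ← hP', nodeCycles, nodeEdge, numLeaves]
    · simp [rootCycle_eq]
    · simp [rootCycle_eq]
    · simp [rootCycle_eq, he]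
    · simp
    · have e1 : after (2 * q, false) (rootCycle P' 0 (node () t₁ t₂)) =
          ((2 * P', true) :: strands 0 (q + t₂.numLeaves)) ++ [(0, false)] := by
        rw [rootCycle_eq, he]
        exact after_append_cons (l₁ := [(0, false)]) (by simp; omega)
      have e2 : after (2 * q, true)
          [(2 * q, true), (rootEdge t₂ q, false), (rootEdge t₁ 0, false)] =
          [(rootEdge t₂ q, false), (rootEdge t₁ 0, false)] :=
        after_append_cons (l₁ := []) (by simp)
      have e3 : after (2 * 0, false) (rootCycle P 0 t₁) =
          (rootEdge t₁ 0, false) :: (2 * P, true) :: strands 0 q :=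
        (after_append_cons (l₁ := []) (by simp)).trans (by rw [List.append_nil]; rfl)
      have e4 : after (2 * 0, true) (rootCycle 0 q t₂) =
          strands q t₂.numLeaves ++ [(2 * q, false), (rootEdge t₂ q, false)] := by
        rw [rootCycle_eq]
        exact after_append_cons (l₁ := [(2 * q, false), (rootEdge t₂ q, false)]) (by simp)
      have e5 := strands_append 0 q t₂.numLeaves
      rw [zero_add] at e5
      rw [e1, e2, e3, e4, ← e5]
      simp only [List.map_append, List.map_cons, List.map_nil, map_swapEdges_strands]
      simp only [swapEdges, Nat.mul_zero, hlast, Equiv.swap_apply_right]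
      rw [Equiv.swap_apply_of_ne_of_ne (x := rootEdge t₁ 0) (by omega) (by omega),
        Equiv.swap_apply_of_ne_of_ne (x := rootEdge t₂ q) (by omega) (by omega)]
      have := List.isRotated_append (l := (2 * P', true) :: (strands 0 q ++
        (strands q t₂.numLeaves ++ [(0, false), (rootEdge t₂ q, false)])))
        (l' := [(rootEdge t₁ 0, false)])
      simpa using this
  exact hx

/-! ### Cyclic rotation of necklaces and its effect on the orientation. -/

/-- The effect on half-edges of a renaming of the edges. -/
def mapEdges (g : ℕ → ℕ) (h : HalfEdge) : HalfEdge := (g h.1, h.2)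

/-- Labels in a tree depend on the root number only through a translation of its block; any renaming
that translates the block carries the tree data along. The same principle governs the next lemmas.
-/
theorem map_rootEdge {g : ℕ → ℕ} {t : PlanarTree} {s s' : ℕ}
    (h : ∀ y < 2 * t.numLeaves, g (2 * s + y) = 2 * s' + y) :
    g (rootEdge t s) = rootEdge t s' := by
  cases t with
  | nil => exact h 1 (by simp)
  | node _ l r =>
    have hr := numLeaves_pos' r
    simp only [numLeaves] at h
    simp only [rootEdge, nodeEdge, Nat.mul_add]
    exact h _ (by omega)

theorem mapEdges_nodeCycles {g : ℕ → ℕ} {t : PlanarTree} {s s' : ℕ}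
    (h : ∀ y < 2 * t.numLeaves, g (2 * s + y) = 2 * s' + y) :
    (nodeCycles t s).map (List.map (mapEdges g)) = nodeCycles t s' := by
  induction t generalizing s s' with
  | nil => rfl
  | node _ l r hl hr =>
    have pr := numLeaves_pos' r
    simp only [numLeaves] at h
    have h1 : ∀ y < 2 * l.numLeaves, g (2 * s + y) = 2 * s' + y := fun y hy => h y (by omega)
    have h2 : ∀ y < 2 * r.numLeaves,
        g (2 * (s + l.numLeaves) + y) = 2 * (s' + l.numLeaves) + y := fun y hy => by
      rw [Nat.mul_add, Nat.mul_add, Nat.add_assoc, Nat.add_assoc]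
      exact h _ (by omega)
    have h3 : g (2 * (s + l.numLeaves)) = 2 * (s' + l.numLeaves) := h2 0 (by omega)
    simp only [nodeCycles, List.map_append, List.map_cons, List.map_nil, hl h1, hr h2, mapEdges,
      map_rootEdge h1, map_rootEdge h2, nodeEdge, h3]

theorem mapEdges_lastRoot {g : ℕ → ℕ} {ts : List PlanarTree} {P P' s s' : ℕ}
    (hP : g (2 * P) = 2 * P') (h : ∀ y < 2 * leaves ts, g (2 * s + y) = 2 * s' + y) :
    g (2 * lastRoot P s ts) = 2 * lastRoot P' s' ts := by
  induction ts generalizing P P' s s' with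
  | nil => exact hP
  | cons t ts ih =>
    have ht := numLeaves_pos' t
    rw [leaves_cons] at h
    refine ih (h 0 (by omega)) fun y hy => ?_
    rw [Nat.mul_add, Nat.mul_add, Nat.add_assoc, Nat.add_assoc]
    exact h _ (by omega)

theorem mapEdges_cycles {g : ℕ → ℕ} {ts : List PlanarTree} {P P' s s' : ℕ}
    (hP : g (2 * P) = 2 * P') (h : ∀ y < 2 * leaves ts, g (2 * s + y) = 2 * s' + y) :
    (cycles P s ts).map (List.map (mapEdges g)) = cycles P' s' ts := by
  induction ts generalizing P P' s s' with
  | nil => rfl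
  | cons t ts ih =>
    have ht := numLeaves_pos' t
    rw [leaves_cons] at h
    have h1 : ∀ y < 2 * t.numLeaves, g (2 * s + y) = 2 * s' + y := fun y hy => h y (by omega)
    have h2 : g (2 * s) = 2 * s' := h 0 (by omega)
    have h3 : (strands s t.numLeaves).map (mapEdges g) = strands s' t.numLeaves := by
      rw [strands, strands, List.range'_eq_map_range, List.range'_eq_map_range, List.map_map,
        List.map_map, List.map_map]
      refine List.map_congr_left fun u hu => ?_
      have hu' := List.mem_range.1 hu
      simp only [Function.comp, mapEdges, leafEdge, Nat.mul_add, Nat.add_assoc]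
      rw [h1 _ (by omega)]
    rw [cycles, cycles, List.map_append, List.map_cons, mapEdges_nodeCycles h1,
      ih (s' := s' + t.numLeaves) h2]
    · simp only [rootCycle_eq, List.map_cons, h3]
      simp only [mapEdges, h2, hP, map_rootEdge h1]
    · intro y hy
      rw [Nat.mul_add, Nat.mul_add, Nat.add_assoc, Nat.add_assoc]
      exact h _ (by omega)

theorem cycles_append (P s : ℕ) (ts us : List PlanarTree) :
    cycles P s (ts ++ us) = cycles P s ts ++ cycles (lastRoot P s ts) (s + leaves ts) us := by
  induction ts generalizing P s with
  | nil => simp [cycles, lastRoot, leaves]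
  | cons t ts ih =>
    rw [List.cons_append, cycles, ih, cycles, List.append_assoc, leaves_cons, ← Nat.add_assoc]
    rfl

theorem lastRoot_append (P s : ℕ) (ts us : List PlanarTree) :
    lastRoot P s (ts ++ us) = lastRoot (lastRoot P s ts) (s + leaves ts) us := by
  induction ts generalizing P s with
  | nil => simp [lastRoot, leaves]
  | cons t ts ih =>
    rw [List.cons_append, lastRoot, ih, leaves_cons, ← Nat.add_assoc]
    rfl

/-- The new names of the edges when the first of the trees, with `d` leaves, is moved to the
end. -/
def shiftEdge (k d e : ℕ) : ℕ := if 2 * d ≤ e then e - 2 * d else e + 2 * (k - d)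

theorem bijOn_shiftEdge {k d : ℕ} (hd : d ≤ k) :
    Set.BijOn (shiftEdge k d) (Finset.range (2 * k)) (Finset.range (2 * k)) := by
  refine ⟨fun x hx => ?_, fun x hx y hy h => ?_, fun y hy => ?_⟩
  · simp only [Finset.coe_range, Set.mem_Iio, shiftEdge] at *
    split_ifs <;> omega
  · simp only [Finset.coe_range, Set.mem_Iio, shiftEdge] at *
    split_ifs at h <;> omega
  · simp only [Finset.coe_range, Set.mem_Iio, Set.mem_image, shiftEdge] at *
    by_cases h : y < 2 * (k - d)
    · exact ⟨y + 2 * d, by omega, by rw [if_pos] <;> omega⟩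
    · exact ⟨y - 2 * (k - d), by omega, by rw [if_neg] <;> omega⟩

/-- The first tree has as many vertices as leaves, so moving it to the end rotates the list of
vertices by `t.numLeaves`. `shiftEdge` translates its block of labels and the block of all other
trees separately. -/
theorem cycles_rotate {k : ℕ} (t : PlanarTree) (ts : List PlanarTree)
    (h : leaves (t :: ts) = k) :
    cycles (lastRoot 0 0 (ts ++ [t])) 0 (ts ++ [t]) =
      ((cycles (lastRoot 0 0 (t :: ts)) 0 (t :: ts)).rotate t.numLeaves).map
        (List.map (mapEdges (shiftEdge k t.numLeaves))) := by
  have ht := numLeaves_pos' t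
  rw [leaves_cons] at h
  set d := t.numLeaves with hd
  have hl : leaves [t] = d := by simp [leaves, hd]
  have h1 : cycles (lastRoot 0 0 (t :: ts)) 0 (t :: ts) =
      cycles (lastRoot 0 0 (t :: ts)) 0 [t] ++ cycles 0 d ts := by
    simp [cycles, hd]
  have hg : ∀ y < 2 * leaves ts, shiftEdge k d (2 * d + y) = 2 * 0 + y := fun y hy => by
    rw [shiftEdge, if_pos (by omega)]
    omega
  have hg0 : shiftEdge k d (2 * 0) = 2 * leaves ts := by
    rw [shiftEdge, if_neg (by omega)]
    omega
  have h2 := List.rotate_append_length_eq (cycles (lastRoot 0 0 (t :: ts)) 0 [t])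
    (cycles 0 d ts)
  rw [length_cycles, hl] at h2
  have h3 : lastRoot 0 0 (ts ++ [t]) = leaves ts := by
    rw [lastRoot_append]
    simp [lastRoot]
  rw [h1, h2, List.map_append, h3, cycles_append, mapEdges_cycles hg0 hg, zero_add]
  congr 1
  refine (mapEdges_cycles ?_ fun y hy => ?_).symm
  · have : lastRoot 0 0 (t :: ts) = lastRoot 0 d ts := by simp [lastRoot, hd]
    rw [this]
    exact mapEdges_lastRoot hg0 hg
  · rw [hl] at hy
    rw [shiftEdge, if_neg (by omega)]
    omega

theorem finRotate_pow_val {k : ℕ} (d : ℕ) (i : Fin k) :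
    (((finRotate k) ^ d) i : ℕ) = (i + d) % k := by
  induction d with
  | zero => simp [Nat.mod_eq_of_lt i.2]
  | succ d ih =>
    obtain ⟨n, rfl⟩ : ∃ n, k = n + 1 := ⟨k - 1, by have := i.2; omega⟩
    rw [pow_succ', Equiv.Perm.mul_apply, finRotate_apply, Fin.val_add, ih, Fin.val_one',
      ← Nat.add_mod, Nat.add_assoc]

/-- Moving the first tree to the end is an isomorphism of ribbon graphs. -/
def rotateIso {k : ℕ} (hk : 0 < k) (t : PlanarTree) (ts : List PlanarTree)
    (h : leaves (t :: ts) = k) (h' : leaves (ts ++ [t]) = k) :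
    RibbonGraph.Iso (graph hk (t :: ts) h) (graph hk (ts ++ [t]) h') where
  edge := shiftEdge k t.numLeaves
  flip := fun _ => false
  -- The vertices of the remaining trees move down by `t.numLeaves`, hence the inverse.
  vertex := ((finRotate k) ^ t.numLeaves)⁻¹
  bijOn := bijOn_shiftEdge (by rw [leaves_cons] at h; omega)
  cyc i := by
    obtain ⟨j, rfl⟩ := ((finRotate k) ^ t.numLeaves).surjective i
    have hfun : (fun e : HalfEdge => (shiftEdge k t.numLeaves e.1,
        xor e.2 ((fun _ => false) e.1))) = mapEdges (shiftEdge k t.numLeaves) := by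
      funext e
      simp [mapEdges]
    rw [hfun, Equiv.Perm.inv_def, Equiv.symm_apply_apply]
    refine ⟨0, ?_⟩
    rw [List.rotate_zero, RibbonGraph.cyc_eq_getElem (ofFn_cyc_graph hk _ h'),
      RibbonGraph.cyc_eq_getElem (ofFn_cyc_graph hk _ h)]
    simp only [cycles_rotate t ts h, List.getElem_map, List.getElem_rotate, length_cycles, h,
      finRotate_pow_val]

/-- No edge is reversed, and a cycle of odd length is an even permutation. This is where the parity
of `k` enters. -/
theorem sgn_rotateIso {k : ℕ} (hk : Odd k) (t : PlanarTree) (ts : List PlanarTree)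
    (h : leaves (t :: ts) = k) (h' : leaves (ts ++ [t]) = k) :
    (rotateIso hk.pos t ts h h').sgn = 1 := by
  obtain ⟨n, hn⟩ := hk
  subst hn
  have h1 : (rotateIso (Nat.succ_pos _) t ts h h').sgn =
    ((Equiv.Perm.sign ((finRotate (2 * n + 1)) ^ t.numLeaves)⁻¹ : ℤ) : ℚ) *
      (-1) ^ ((Finset.range (2 * (2 * n + 1))).filter fun _ => false = true).card := rfl
  rw [h1, Equiv.Perm.sign_inv, map_pow, sign_finRotate]
  simp

/-! ### Sums over the summands of all ornate necklaces -/

theorem leaves_perm {ts us : List PlanarTree} (h : ts ~ us) : leaves ts = leaves us :=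
  (h.map numLeaves).sum_eq

theorem leaves_rotate (ts : List PlanarTree) (j : ℕ) : leaves (ts.rotate j) = leaves ts :=
  leaves_perm (List.rotate_perm ts j)

theorem length_le_leaves (ts : List PlanarTree) : ts.length ≤ leaves ts := by
  induction ts with
  | nil => simp
  | cons t ts ih =>
    have := numLeaves_pos' t
    rw [leaves_cons, List.length_cons]
    omega

theorem toRG_graph_rotate {k : ℕ} (hk : Odd k) (j : ℕ) (ts : List PlanarTree)
    (h : leaves ts = k) : (graph hk.pos ts h).toRG =
      (graph hk.pos (ts.rotate j) ((leaves_rotate ts j).trans h)).toRG := by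
  induction j generalizing ts with
  | zero => simp
  | succ j ih =>
    cases ts with
    | nil => simp
    | cons t ts =>
      have h' : leaves (ts ++ [t]) = k := (leaves_perm (List.perm_append_singleton t ts)).trans h
      rw [RibbonGraph.toRG_eq (rotateIso hk.pos t ts h h'), sgn_rotateIso hk, one_smul, ih _ h']
      simp only [List.rotate_cons_succ]

/-- Rotating the sequences of trees is a bijection between the summands, and by `toRG_graph_rotate`
corresponding summands are equal. -/
theorem ornate_eq_of_isRotated {k : ℕ} (hk : Odd k) {c c' : Composition k}
    (h : c.blocks ~r c'.blocks) : ornate hk.pos c = ornate hk.pos c' := by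
  obtain ⟨j, hj⟩ := h
  have hmap : ∀ ts : TreeChoice c.blocks, (ts.1.rotate j).map numLeaves = c'.blocks := fun ts => by
    rw [List.map_rotate, ts.2, hj]
  let f : TreeChoice c.blocks → TreeChoice c'.blocks := fun ts => ⟨ts.1.rotate j, hmap ts⟩
  have hf : Function.Bijective f := by
    refine ⟨fun ts us htu => Subtype.ext (List.rotate_injective j (congrArg Subtype.val htu)),
      fun us => ?_⟩
    obtain ⟨ts, hts⟩ : ∃ ts : List PlanarTree, ts.rotate j = us.1 :=
      ⟨_, List.rotate_eq_iff.2 rfl⟩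
    refine ⟨⟨ts, List.rotate_injective j ?_⟩, Subtype.ext hts⟩
    change (ts.map numLeaves).rotate j = c.blocks.rotate j
    rw [← List.map_rotate, hts, us.2, hj]
  exact Fintype.sum_bijective f hf _ _ fun ts =>
    toRG_graph_rotate hk j ts.1 (by rw [leaves, ts.2, c.blocks_sum])

/-- The sequences of trees with `k` leaves in total. -/
abbrev AllTrees (k : ℕ) : Type := {ts : List PlanarTree // leaves ts = k}

/-- A sequence of trees is a sequence of numbers of leaves with a choice of trees. -/
def sigmaTreeChoiceEquiv (k : ℕ) : (Σ c : Composition k, TreeChoice c.blocks) ≃ AllTrees k where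
  toFun x := ⟨x.2.1, by rw [leaves, x.2.2, x.1.blocks_sum]⟩
  invFun ts := ⟨⟨ts.1.map numLeaves, fun {i} hi => by
    obtain ⟨t, -, rfl⟩ := List.mem_map.1 hi
    exact numLeaves_pos' t, ts.2⟩, ts.1, rfl⟩
  left_inv := by
    rintro ⟨⟨l, hl, hs⟩, ts, hts⟩
    dsimp only at hts
    subst hts
    rfl
  right_inv ts := rfl

noncomputable instance (k : ℕ) : Fintype (AllTrees k) :=
  Fintype.ofEquiv _ (sigmaTreeChoiceEquiv k)

/-- Rotation of sequences of trees. -/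
def rotateTrees (k j : ℕ) : AllTrees k → AllTrees k := fun ts =>
  ⟨ts.1.rotate j, (leaves_rotate ts.1 j).trans ts.2⟩

theorem rotateTrees_bijective (k j : ℕ) : Function.Bijective (rotateTrees k j) :=
  Finite.injective_iff_bijective.1 fun _ _ h =>
    Subtype.ext (List.rotate_injective j (congrArg Subtype.val h))

/-- For fixed `j`, rotation by `j` permutes the sequences with more than `j` trees and preserves
their length. The length is a separate argument of `f` so that weights such as `(-1)^n / n` can be
carried along. -/
theorem sum_sum_rotate {k : ℕ} {V : Type*} [AddCommMonoid V] (f : ℕ → List PlanarTree → V) :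
    ∑ ts : AllTrees k, ∑ j ∈ Finset.range ts.1.length, f ts.1.length (ts.1.rotate j) =
      ∑ ts : AllTrees k, ts.1.length • f ts.1.length ts.1 := by
  have h : ∀ F : ℕ → List PlanarTree → V,
      ∑ ts : AllTrees k, ∑ j ∈ Finset.range ts.1.length, F j ts.1 =
        ∑ j ∈ Finset.range k, ∑ ts : AllTrees k with j < ts.1.length, F j ts.1 := fun F => by
    -- The bound `k` on `j` loses nothing, because every tree has at least one leaf.
    refine Finset.sum_comm' fun ts j => ?_
    have := length_le_leaves ts.1
    have := ts.2
    simp only [Finset.mem_univ, Finset.mem_range, Finset.mem_filter, true_and]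
    omega
  have h1 := h fun j ts => f ts.length (ts.rotate j)
  have h2 := h fun _ ts => f ts.length ts
  simp only [Finset.sum_const, Finset.card_range] at h2
  rw [h1, h2]
  refine Finset.sum_congr rfl fun j _ => ?_
  refine Finset.sum_bijective (rotateTrees k j) (rotateTrees_bijective k j) (fun ts => ?_)
    fun ts _ => ?_
  · simp [rotateTrees]
  · simp [rotateTrees]

/-! ### The orbits of cyclic permutations -/

/-- A cyclic permutation of a sequence of positive integers. -/
def rotateComposition {k : ℕ} (c : Composition k) (j : ℕ) : Composition k where
  blocks := c.blocks.rotate j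
  blocks_pos hi := c.blocks_pos (List.mem_rotate.1 hi)
  blocks_sum := (List.rotate_perm _ _).sum_eq.trans c.blocks_sum

-- Orbit-stabilizer for the rotations of `c`: they map onto the class, and each fibre is a translate
-- of the set of symmetries.
open Classical in
theorem card_class_mul_symmetries {k : ℕ} (c : Composition k) (hc : 0 < c.length) :
    (Finset.univ.filter fun c' : Composition k => c'.blocks ~r c.blocks).card * symmetries c =
      c.length := by
  have : NeZero c.length := ⟨hc.ne'⟩
  have h1 := Finset.card_eq_sum_card_fiberwise (s := (Finset.univ : Finset (Fin c.length)))
    (t := Finset.univ.filter fun c' : Composition k => c'.blocks ~r c.blocks)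
    (f := fun r : Fin c.length => rotateComposition c r) (fun r _ => by
      simp only [Finset.coe_filter, Finset.mem_univ, true_and, Set.mem_ofPred_eq]
      exact List.IsRotated.symm ⟨r, rfl⟩)
  rw [Finset.card_univ, Fintype.card_fin] at h1
  conv_rhs => rw [h1]
  rw [← smul_eq_mul, ← Finset.sum_const]
  refine Finset.sum_congr rfl fun c' hc' => ?_
  obtain ⟨m, hm⟩ := (Finset.mem_filter.1 hc').2.symm
  set r₀ : Fin c.length := ⟨m % c.length, Nat.mod_lt _ hc⟩ with hr₀
  have hm' : c.blocks.rotate r₀ = c'.blocks := by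
    rw [← hm]
    exact List.rotate_mod _ _
  have hadd : ∀ r : Fin c.length, c.blocks.rotate ((r + r₀ : Fin c.length) : ℕ) =
      (c.blocks.rotate r).rotate r₀ := fun r => by
    rw [Fin.val_add, List.rotate_rotate]
    exact List.rotate_mod _ _
  rw [symmetries]
  -- Adding `r₀`, a rotation that takes `c` to `c'`, carries the symmetries of `c` to the fibre over
  -- `c'`.
  refine Finset.card_bijective (fun r => r + r₀) (Equiv.addRight r₀).bijective fun r => ?_
  simp only [Finset.mem_filter, Finset.mem_univ, true_and, Composition.ext_iff,
    rotateComposition, hadd]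
  rw [← hm']
  exact (List.rotate_injective r₀).eq_iff.symm

/-- A class has `length / symmetries` members with equal necklaces and equal signs, so the weight `1
/ symmetries` on the class amounts to `1 / length` on each member. -/
theorem Z_eq_sum {k : ℕ} (hk : Odd k) : Z hk.pos =
    ∑ c : Composition k, ((-1 : ℚ) ^ c.length / (c.length : ℚ)) • ornate hk.pos c := by
  classical
  rw [Z, ← Finset.sum_fiberwise (s := (Finset.univ : Finset (Composition k)))
    (g := fun c => (Quotient.mk (rotationSetoid k) c))]
  refine Finset.sum_congr rfl fun q _ => ?_
  have hq : ∀ c : Composition k, Quotient.mk (rotationSetoid k) c = q ↔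
      c.blocks ~r q.out.blocks := fun c => by
    conv_lhs => rw [← q.out_eq]
    exact Quotient.eq
  have hpos : 0 < q.out.length := Composition.length_pos_of_pos _ hk.pos
  have hcard := card_class_mul_symmetries q.out hpos
  have hsum : ∑ c : Composition k with Quotient.mk (rotationSetoid k) c = q,
      ((-1 : ℚ) ^ c.length / (c.length : ℚ)) • ornate hk.pos c =
      ∑ c : Composition k with Quotient.mk (rotationSetoid k) c = q,
      ((-1 : ℚ) ^ q.out.length / (q.out.length : ℚ)) • ornate hk.pos q.out := by
    refine Finset.sum_congr rfl fun c hc => ?_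
    have h := (hq c).1 (Finset.mem_filter.1 hc).2
    rw [ornate_eq_of_isRotated hk h, show c.length = q.out.length from h.perm.length_eq]
  rw [hsum, Finset.sum_const, ← Nat.cast_smul_eq_nsmul ℚ, smul_smul]
  simp only [hq]
  congr 1
  have h1 : (symmetries q.out : ℚ) ≠ 0 := by
    intro h0
    rw [Nat.cast_eq_zero.1 h0] at hcard
    omega
  have h2 : (q.out.length : ℚ) ≠ 0 := Nat.cast_ne_zero.2 hpos.ne'
  rw [div_eq_iff h1, mul_comm, ← mul_assoc, div_eq_mul_inv]
  rw [show (q.out.length : ℚ) = ((_ * _ : ℕ) : ℚ) from congrArg _ hcard.symm] at h2 ⊢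
  push_cast at h2 ⊢
  have h3 := left_ne_zero_of_mul h2
  field_simp

/-! ### Moving the contracted edge to the first tree. -/

/-- The contribution of an edge to the boundary of the graph with the trees `ts`. -/
noncomputable def edgeContraction {k : ℕ} (hk : 0 < k) (ts : List PlanarTree) (e : ℕ) :
    RG (k - 1) :=
  if h : leaves ts = k then (graph hk ts h).contraction e else 0

theorem edgeContraction_of_leaves {k : ℕ} (hk : 0 < k) {ts : List PlanarTree}
    (h : leaves ts = k) (e : ℕ) : edgeContraction hk ts e = (graph hk ts h).contraction e :=
  dif_pos h

theorem edgeContraction_rotate {k : ℕ} (hk : Odd k) (t : PlanarTree) (ts : List PlanarTree)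
    (h : leaves (t :: ts) = k) {e : ℕ} (he : e < 2 * k) :
    edgeContraction hk.pos (t :: ts) e =
      edgeContraction hk.pos (ts ++ [t]) (shiftEdge k t.numLeaves e) := by
  have h' : leaves (ts ++ [t]) = k := (leaves_perm (List.perm_append_singleton t ts)).trans h
  rw [edgeContraction_of_leaves _ h, edgeContraction_of_leaves _ h',
    RibbonGraph.contraction_iso (rotateIso hk.pos t ts h h') (Finset.mem_range.2 he),
    sgn_rotateIso hk, one_smul]
  rfl

/-- A choice of one edge for each tree and root number, compatible with renumberings. -/
structure IsEdgeChoice (E : PlanarTree → ℕ → ℕ) : Prop where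
  bounds : ∀ t s, 2 * s ≤ E t s ∧ E t s < 2 * (s + t.numLeaves)
  map : ∀ (g : ℕ → ℕ) (t : PlanarTree) (s s' : ℕ),
    (∀ y < 2 * t.numLeaves, g (2 * s + y) = 2 * s' + y) → g (E t s) = E t s'

theorem isEdgeChoice_rootEdge : IsEdgeChoice rootEdge where
  bounds t s := ⟨(rootEdge_bounds t s).1.le, (rootEdge_bounds t s).2⟩
  map _ _ _ _ h := map_rootEdge h

theorem isEdgeChoice_loopEdge : IsEdgeChoice fun _ s => loopEdge s where
  bounds t s := by
    have := numLeaves_pos' t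
    simp only [loopEdge]
    omega
  map _ t s _ h := h 0 (by have := numLeaves_pos' t; omega)

/-- The chosen edges of the trees `ts`, the first root having the number `s`. -/
def edgeList (E : PlanarTree → ℕ → ℕ) (s : ℕ) (ts : List PlanarTree) : List ℕ :=
  List.zipWith E ts (roots s ts)

theorem IsEdgeChoice.mem_bounds {E : PlanarTree → ℕ → ℕ} (hE : IsEdgeChoice E)
    {ts : List PlanarTree} {s x : ℕ} (h : x ∈ edgeList E s ts) :
    2 * s ≤ x ∧ x < 2 * (s + leaves ts) := by
  induction ts generalizing s with
  | nil => simp [edgeList, roots] at h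
  | cons t ts ih =>
    have h1 := hE.bounds t s
    rw [leaves_cons]
    rcases List.mem_cons.1 h with rfl | h
    · omega
    · have := ih h
      omega

theorem IsEdgeChoice.nodup {E : PlanarTree → ℕ → ℕ} (hE : IsEdgeChoice E) (s : ℕ)
    (ts : List PlanarTree) : (edgeList E s ts).Nodup := by
  induction ts generalizing s with
  | nil => simp [edgeList, roots]
  | cons t ts ih =>
    refine List.nodup_cons.2 ⟨fun h => ?_, ih _⟩
    have h1 := hE.bounds t s
    have h2 := hE.mem_bounds h
    omega

theorem IsEdgeChoice.map_edgeList {E : PlanarTree → ℕ → ℕ} (hE : IsEdgeChoice E)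
    {g : ℕ → ℕ} {ts : List PlanarTree} {s s' : ℕ}
    (h : ∀ y < 2 * leaves ts, g (2 * s + y) = 2 * s' + y) :
    (edgeList E s ts).map g = edgeList E s' ts := by
  induction ts generalizing s s' with
  | nil => rfl
  | cons t ts ih =>
    rw [leaves_cons] at h
    refine congrArg₂ List.cons (hE.map g t s s' fun y hy => h y (by omega)) ?_
    refine ih fun y hy => ?_
    rw [Nat.mul_add, Nat.mul_add, Nat.add_assoc, Nat.add_assoc]
    exact h _ (by omega)

/-- The contribution of the chosen edge of the first tree. -/
noncomputable def headContraction {k : ℕ} (hk : 0 < k) (E : PlanarTree → ℕ → ℕ) :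
    List PlanarTree → RG (k - 1)
  | [] => 0
  | t :: ts => edgeContraction hk (t :: ts) (E t 0)

/-- Rotating by `j` turns the chosen edge of tree `j` into that of the first tree, without a sign.
In the induction `vs` collects the trees already moved to the back, so that each step is a single
rotation of the whole necklace. -/
theorem IsEdgeChoice.sum_edgeList {E : PlanarTree → ℕ → ℕ} (hE : IsEdgeChoice E) {k : ℕ}
    (hk : Odd k) (us vs : List PlanarTree) (h : leaves (us ++ vs) = k) :
    ((edgeList E 0 us).map (edgeContraction hk.pos (us ++ vs))).sum =
      ∑ j ∈ Finset.range us.length, headContraction hk.pos E ((us ++ vs).rotate j) := by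
  induction us generalizing vs with
  | nil => simp [edgeList, roots]
  | cons u us ih =>
    have h' : leaves (us ++ (vs ++ [u])) = k := by
      rw [← h, ← List.append_assoc]
      exact leaves_perm (List.perm_append_singleton u (us ++ vs))
    have hk' : u.numLeaves + leaves us ≤ k := by
      rw [← h, ← leaves_cons]
      simp [leaves]
    have h1 : (edgeList E u.numLeaves us).map (edgeContraction hk.pos (u :: us ++ vs)) =
        (edgeList E 0 us).map (edgeContraction hk.pos (us ++ (vs ++ [u]))) := by
      rw [← hE.map_edgeList (g := shiftEdge k u.numLeaves) (s := u.numLeaves) (s' := 0)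
        fun y hy => ?_, List.map_map]
      · refine List.map_congr_left fun e he => ?_
        have := hE.mem_bounds he
        rw [List.cons_append, edgeContraction_rotate hk u (us ++ vs) h (by omega),
          List.append_assoc]
        rfl
      · rw [shiftEdge, if_pos (by omega)]
        omega
    have h2 : edgeList E 0 (u :: us) = E u 0 :: edgeList E u.numLeaves us := by
      simp [edgeList, roots]
    rw [h2, List.map_cons, List.sum_cons, h1, ih _ h', List.length_cons,
      Finset.sum_range_succ', add_comm, List.rotate_zero]
    refine congrArg₂ _ ?_ rfl
    refine Finset.sum_congr rfl fun j _ => ?_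
    rw [List.cons_append, List.rotate_cons_succ, List.append_assoc]

theorem sum_root_loop {k : ℕ} (hk : Odd k) {ts : List PlanarTree} (h : leaves ts = k) :
    ∑ e ∈ rootEdges ts ∪ loopEdges ts, (graph hk.pos ts h).contraction e =
      ∑ j ∈ Finset.range ts.length, (headContraction hk.pos rootEdge (ts.rotate j) +
        headContraction hk.pos (fun _ s => loopEdge s) (ts.rotate j)) := by
  have hr : rootEdges ts = (edgeList rootEdge 0 ts).toFinset := rfl
  have hloop : ∀ s, (roots s ts).map loopEdge = edgeList (fun _ s => loopEdge s) s ts := by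
    clear h hr
    induction ts with
    | nil => exact fun _ => rfl
    | cons t ts ih => exact fun s => congrArg₂ List.cons rfl (ih _)
  have hl : loopEdges ts = (edgeList (fun _ s => loopEdge s) 0 ts).toFinset := by
    rw [loopEdges, hloop]
  -- In each block the loop edge has the lowest label and the root edge a strictly larger one, so
  -- the sum over the union splits.
  have hdisj : ∀ s, ∀ x ∈ edgeList rootEdge s ts,
      x ∉ edgeList (fun _ s => loopEdge s) s ts := by
    clear h hr hl hloop
    induction ts with
    | nil => simp [edgeList, roots]
    | cons t ts ih =>
      intro s x hx hx'
      have hb := rootEdge_bounds t s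
      have ht := numLeaves_pos' t
      rcases List.mem_cons.1 hx with rfl | hx <;> rcases List.mem_cons.1 hx' with hx' | hx'
      · simp only [loopEdge] at hx'
        omega
      · have := isEdgeChoice_loopEdge.mem_bounds hx'
        omega
      · simp only [loopEdge] at hx'
        have := isEdgeChoice_rootEdge.mem_bounds hx
        omega
      · exact ih _ x hx hx'
  rw [Finset.sum_union (by
    rw [hr, hl, Finset.disjoint_left]
    intro x hx hx'
    exact hdisj 0 x (List.mem_toFinset.1 hx) (List.mem_toFinset.1 hx')), hr, hl,
    List.sum_toFinset _ (isEdgeChoice_rootEdge.nodup 0 ts),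
    List.sum_toFinset _ (isEdgeChoice_loopEdge.nodup 0 ts), Finset.sum_add_distrib]
  have h1 := isEdgeChoice_rootEdge.sum_edgeList hk ts [] (by rwa [List.append_nil])
  have h2 := isEdgeChoice_loopEdge.sum_edgeList hk ts [] (by rwa [List.append_nil])
  rw [List.append_nil, show edgeContraction hk.pos ts = _ from
    funext (edgeContraction_of_leaves hk.pos h)] at h1 h2
  rw [h1, h2]

/-! ### Cancellation of loop edges against root edges. -/

/-- With a single tree the large loop is one edge returning to the same root. -/
theorem headContraction_loopEdge_singleton {k : ℕ} (hk : 0 < k) (t : PlanarTree) :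
    headContraction hk (fun _ s => loopEdge s) [t] = 0 := by
  rw [headContraction, edgeContraction]
  split_ifs with h
  · obtain ⟨i, hi⟩ : ∃ i, (graph hk [t] h).cyc i = rootCycle 0 0 t :=
      exists_vertexCycle [t] h (by simp [cycles, lastRoot])
    refine RibbonGraph.contraction_of_eq _ (a := i) ?_ ?_ <;> rw [hi] <;> simp [rootCycle]
  · rfl

theorem headContraction_rootEdge_nil {k : ℕ} (hk : 0 < k) (ts : List PlanarTree) :
    headContraction hk rootEdge (nil :: ts) = 0 := by
  rw [headContraction, edgeContraction]
  split_ifs with h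
  · obtain ⟨i, hi⟩ : ∃ i, (graph hk (nil :: ts) h).cyc i =
        rootCycle (lastRoot 0 0 (nil :: ts)) 0 nil :=
      exists_vertexCycle _ h (by simp [cycles])
    refine RibbonGraph.contraction_of_eq _ (a := i) ?_ ?_ <;> rw [hi] <;>
      simp [rootCycle, rootEdge]
  · rfl

/-- Join the first two trees. -/
def joinFirst : List PlanarTree → List PlanarTree
  | t₁ :: t₂ :: ts => node () t₁ t₂ :: ts
  | ts => ts

theorem leaves_joinFirst (ts : List PlanarTree) : leaves (joinFirst ts) = leaves ts := by
  match ts with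
  | [] => rfl
  | [t] => rfl
  | t₁ :: t₂ :: ts => simp [joinFirst, leaves_cons, numLeaves, Nat.add_assoc]

/-- Joining the first two trees is a bijection from the sequences with at least two trees to those
whose first tree has an internal vertex. The sequences left out contribute contractions of loops,
and the drop in length by one gives the sign. -/
theorem sum_headContraction_loopEdge {k : ℕ} (hk : 0 < k) :
    ∑ ts : AllTrees k, (-1 : ℚ) ^ ts.1.length •
        headContraction hk (fun _ s => loopEdge s) ts.1 =
      ∑ ts : AllTrees k, -((-1 : ℚ) ^ ts.1.length • headContraction hk rootEdge ts.1) := by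
  rw [← Finset.sum_filter_of_ne (p := fun ts : AllTrees k => 2 ≤ ts.1.length)]
  · refine Finset.sum_of_injOn
      (fun ts => (⟨joinFirst ts.1, (leaves_joinFirst ts.1).trans ts.2⟩ : AllTrees k))
      ?_ (fun _ _ => Finset.mem_coe.2 (Finset.mem_univ _)) ?_ ?_
    · rintro ⟨ts, h⟩ hts ⟨us, h'⟩ hus heq
      simp only [Finset.coe_filter, Finset.mem_univ, true_and, Set.mem_ofPred_eq] at hts hus
      rw [Subtype.mk.injEq] at heq ⊢
      rcases ts with _ | ⟨t₁, _ | ⟨t₂, ts⟩⟩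
      · simp at hts
      · simp at hts
      rcases us with _ | ⟨u₁, _ | ⟨u₂, us⟩⟩
      · simp at hus
      · simp at hus
      simp only [joinFirst, List.cons.injEq, node.injEq, true_and] at heq
      rw [heq.1.1, heq.1.2, heq.2]
    -- A sequence outside the image begins with a one-leaf tree or is empty; a first tree with an
    -- internal vertex could be split into its branches.
    · rintro ⟨ts, h⟩ - hts
      rcases ts with _ | ⟨_ | ⟨_, t₁, t₂⟩, ts⟩
      · simp [headContraction]
      · simp [headContraction_rootEdge_nil]
      · refine absurd ⟨⟨t₁ :: t₂ :: ts,
          (leaves_joinFirst (t₁ :: t₂ :: ts)).symm.trans h⟩, ?_, rfl⟩ hts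
        simp
    · rintro ⟨ts, h⟩ hts
      simp only [Finset.mem_filter, Finset.mem_univ, true_and] at hts
      rcases ts with _ | ⟨t₁, _ | ⟨t₂, ts⟩⟩
      · simp at hts
      · simp at hts
      have h' : leaves (node () t₁ t₂ :: ts) = k :=
        (leaves_joinFirst (t₁ :: t₂ :: ts)).trans h
      simp only [joinFirst, headContraction]
      rw [edgeContraction_of_leaves _ h, edgeContraction_of_leaves _ h',
        contraction_loopEdge_eq hk t₁ t₂ ts h h', List.length_cons, List.length_cons,
        List.length_cons, pow_succ _ (ts.length + 1), mul_neg_one, neg_smul]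
  · rintro ⟨ts, h⟩ - hne
    rcases ts with _ | ⟨t₁, _ | ⟨t₂, ts⟩⟩
    · simp [headContraction] at hne
    · simp [headContraction_loopEdge_singleton] at hne
    · simp

/-- Over all sequences of trees, the `n` rotations of a sequence of length `n` cancel its weight `1
/ n`. What remains is the alternating sum of the contributions of the first tree, where loop terms
and root terms are opposite. -/
theorem reducedBoundary_Z {k : ℕ} (hk : Odd k) :
    reducedBoundaryMap k (reduce k (Z hk.pos)) = 0 := by
  set H : List PlanarTree → RG (k - 1) := fun ts => headContraction hk.pos rootEdge ts +
    headContraction hk.pos (fun _ s => loopEdge s) ts with hH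
  have h1 : reducedBoundaryMap k (reduce k (Z hk.pos)) =
      ∑ c : Composition k, ∑ ts : TreeChoice c.blocks,
        ((-1 : ℚ) ^ ts.1.length / (ts.1.length : ℚ)) •
          reduce (k - 1) (∑ j ∈ Finset.range ts.1.length, H (ts.1.rotate j)) := by
    rw [Z_eq_sum hk, map_sum, map_sum]
    refine Finset.sum_congr rfl fun c _ => ?_
    rw [map_smul, map_smul, reducedBoundary_ornate, Finset.smul_sum]
    refine Finset.sum_congr rfl fun ts _ => ?_
    have hlen : c.length = ts.1.length :=
      (congrArg List.length ts.2).symm.trans (List.length_map _)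
    rw [hlen, ← map_sum]
    congr 2
    exact sum_root_loop hk _
  have h2 : ∑ c : Composition k, ∑ ts : TreeChoice c.blocks,
        ((-1 : ℚ) ^ ts.1.length / (ts.1.length : ℚ)) •
          reduce (k - 1) (∑ j ∈ Finset.range ts.1.length, H (ts.1.rotate j)) =
      ∑ ts : AllTrees k, ∑ j ∈ Finset.range ts.1.length,
        ((-1 : ℚ) ^ ts.1.length / (ts.1.length : ℚ)) • reduce (k - 1) (H (ts.1.rotate j)) := by
    simp only [map_sum, Finset.smul_sum]
    rw [← Fintype.sum_sigma (f := fun x : (Σ c : Composition k, TreeChoice c.blocks) =>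
      ∑ j ∈ Finset.range x.2.1.length, ((-1 : ℚ) ^ x.2.1.length / (x.2.1.length : ℚ)) •
        reduce (k - 1) (H (x.2.1.rotate j)))]
    exact Fintype.sum_equiv (sigmaTreeChoiceEquiv k) _ _ fun _ => rfl
  have h3 : ∑ ts : AllTrees k, ts.1.length • ((-1 : ℚ) ^ ts.1.length / (ts.1.length : ℚ)) •
      reduce (k - 1) (H ts.1) =
      reduce (k - 1) (∑ ts : AllTrees k, (-1 : ℚ) ^ ts.1.length • H ts.1) := by
    rw [map_sum]
    refine Finset.sum_congr rfl fun ts _ => ?_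
    -- An empty sequence would have no leaves, but `k` is positive.
    have hne : (ts.1.length : ℚ) ≠ 0 := by
      rw [Nat.cast_ne_zero]
      intro h
      have h4 := ts.2
      rw [List.length_eq_zero_iff.1 h] at h4
      exact hk.pos.ne h4
    rw [← Nat.cast_smul_eq_nsmul ℚ, smul_smul, mul_div_cancel₀ _ hne, map_smul]
  rw [h1, h2, sum_sum_rotate fun n ts =>
    ((-1 : ℚ) ^ n / (n : ℚ)) • reduce (k - 1) (H ts), h3]
  simp only [hH, smul_add]
  rw [Finset.sum_add_distrib, sum_headContraction_loopEdge, ← Finset.sum_add_distrib]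
  simp

end Necklace

theorem mainTheorem2 :
    -- which edge contractions contribute to the boundary of an ornate necklace
    (∀ (k : ℕ) (hk : 0 < k) (c : Composition k),
      -- the contractions of interior tree edges cancel in pairs
      (∃ f : (Σ ts : Necklace.TreeChoice c.blocks, {e : ℕ // e ∈ Necklace.interiorEdges ts.1}) →
          (Σ ts : Necklace.TreeChoice c.blocks, {e : ℕ // e ∈ Necklace.interiorEdges ts.1}),
        Function.Involutive f ∧ ∀ x, f x ≠ x ∧
          (Necklace.summand hk c (f x).1).contraction (f x).2 =
            -(Necklace.summand hk c x.1).contraction x.2) ∧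
      -- the contractions of edges from the tops of the trees have cut vertices
      (∀ (ts : Necklace.TreeChoice c.blocks) (e : ℕ) (a b : Fin k) (hab : a ≠ b)
        (ha : (e, false) ∈ (Necklace.summand hk c ts).cyc a)
        (hb : (e, true) ∈ (Necklace.summand hk c ts).cyc b),
        e ∈ Necklace.topEdges ts.1 →
          ((Necklace.summand hk c ts).contract e a b hab ha hb).HasCutVertex) ∧
      -- only root edges and edges of the large loop contribute in the reduced complex
      reducedBoundaryMap k (reduce k (Necklace.ornate hk c)) =
        ∑ ts : Necklace.TreeChoice c.blocks,
          ∑ e ∈ Necklace.rootEdges ts.1 ∪ Necklace.loopEdges ts.1,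
            reduce (k - 1) ((Necklace.summand hk c ts).contraction e)) ∧
    -- contracting the loop edge between two neighbouring trees `t₁`, `t₂` gives the same
    -- oriented graph as contracting the root edge of the tree with branches `t₁`, `t₂`
    (∀ (k : ℕ) (hk : 0 < k) (t₁ t₂ : Necklace.PlanarTree) (ts : List Necklace.PlanarTree)
      (hA : Necklace.leaves (t₁ :: t₂ :: ts) = k)
      (hB : Necklace.leaves (BinaryTree.node () t₁ t₂ :: ts) = k),
      (Necklace.graph hk (t₁ :: t₂ :: ts) hA).contraction (Necklace.loopEdge 0) =
        (Necklace.graph hk (BinaryTree.node () t₁ t₂ :: ts) hB).contraction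
          (Necklace.rootEdge (BinaryTree.node () t₁ t₂) 0)) ∧
    -- for odd `k`, ornate necklaces are invariant under cyclic permutations, so that `Z_k` does
    -- not depend on the chosen representatives, and `Z_k` is a cycle in the reduced complex
    (∀ (k : ℕ) (hk : Odd k),
      (∀ c c' : Composition k, c.blocks ~r c'.blocks →
        Necklace.ornate hk.pos c = Necklace.ornate hk.pos c') ∧
      reducedBoundaryMap k (reduce k (Necklace.Z hk.pos)) = 0) := by
  refine ⟨fun k hk c => ⟨Necklace.exists_involution hk c, fun ts e a b hab ha hb he =>
    Necklace.contract_topEdge_hasCutVertex hk _ hab ha hb he,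
    Necklace.reducedBoundary_ornate hk c⟩, fun k hk t₁ t₂ ts hA hB =>
    Necklace.contraction_loopEdge_eq hk t₁ t₂ ts hA hB, fun k hk =>
    ⟨fun c c' h => Necklace.ornate_eq_of_isRotated hk h, Necklace.reducedBoundary_Z hk⟩⟩
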